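/- Let $p=p(n)\in[0,1]$ satisfy $n^{-1/2}\ll p\ll 1$ as $n\to\infty$ (that is, $n^{-1/2}=o(p)$ and $p=o(1)$), and let $G(n,p)$ be the binomial random graph on $n$ labelled vertices. An event holds with high probability if its probability tends to $1$ as $n\to\infty$. Write $\chi$ for the chromatic number and $\delta$ for the minimum degree of a graph. (1) For all integers $r\ge 4$ and $s\ge 0$ and every real $\gamma>0$, with high probability $G(n,p)$ contains a spanning subgraph $G$ with $$\chi(G)\ge s\qquad\text{and}\qquad \delta(G)\ge\Big(\frac{r-2}{r-1}-\gamma\Big)pn,$$ such that every $s$-vertex subgraph of $G$ is $(r-1)$-colourable. (2) In particular, $\delta_\chi(H,p)\ge\pi(H)$ for every finite graph $H$ with $\chi(H)\ge 4$. Here $\pi(H)=1-\frac{1}{\chi(H)-1}$, and $\delta_\chi(H,p)$, the chromatic threshold of $H$ with respect to $p$, is the infimum of all $d>0$ for which there exists a constant $C>0$ (not depending on $n$) such that, with high probability, every spanning subgraph $G\subset G(n,p)$ that contains no copy of $H$ and has $\delta(G)\ge dpn$ satisfies $\chi(G)\le C$. -/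

import Mathlib

open Filter Asymptotics

namespace SparseChromatic

/-- The event `P`, a property of graphs on `n` labelled vertices for each `n`, holds with high
probability in the binomial random graph `G(n, p(n))`: its probability tends to `1`. -/
def Whp (p : ℕ → unitInterval) (P : (n : ℕ) → SimpleGraph (Fin n) → Prop) : Prop :=
  Tendsto (fun n : ℕ => SimpleGraph.binomialRandom (Fin n) (p n) {Γ | P n Γ}) atTop (nhds 1)

open Classical in
/-- The minimum degree `δ(G)` of a graph on `n` labelled vertices. -/
noncomputable def minDeg {n : ℕ} (G : SimpleGraph (Fin n)) : ℕ := G.minDegree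

/-- The set of densities `d > 0` for which there is a constant `C > 0` such that, with high
probability, every `H`-free spanning subgraph `G` of `G(n, p)` with `δ(G) ≥ d p n` has
`χ(G) ≤ C`. Spanning subgraphs of `Γ` are the graphs `G ≤ Γ` on the same vertex set; `H.Free G`
says that `G` contains no (not necessarily induced) copy of `H`. -/
def chromaticThresholdSet {W : Type*} (H : SimpleGraph W) (p : ℕ → unitInterval) : Set ℝ :=
  {d : ℝ | 0 < d ∧ ∃ C : ℕ, 0 < C ∧ Whp p fun n Γ =>
    ∀ G : SimpleGraph (Fin n), G ≤ Γ → H.Free G → d * (p n : ℝ) * (n : ℝ) ≤ (minDeg G : ℝ) →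
      G.chromaticNumber ≤ (C : ℕ∞)}

/-- The chromatic threshold `δ_χ(H, p)` of `H` with respect to `p`. -/
noncomputable def chromaticThreshold {W : Type*} (H : SimpleGraph W) (p : ℕ → unitInterval) : ℝ :=
  sInf (chromaticThresholdSet H p)

/-- `π(H) = 1 - 1 / (χ(H) - 1)`, for a graph `H` with finite chromatic number at least `2`. -/
noncomputable def piDensity {W : Type*} (H : SimpleGraph W) : ℝ :=
  1 - 1 / ((H.chromaticNumber.toNat : ℝ) - 1)

end SparseChromatic

/-! The graph `G` is `Γ` with a small, locally bipartite obstruction `X` of large chromatic number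
planted in it, surrounded by an `(r-1)`-partite graph of nearly full degree.

The obstruction imitates a shift graph on `(2s+1)`-tuples. Such graphs have unbounded chromatic
number (`exists_not_colorable_shiftGraph`), yet any `s` vertices mapping homomorphically to one span
a bipartite graph (`colorable_two_of_hom_shiftGraph`). Each tuple is replaced by a level, a set of
order `1/p` vertices, and the edges of `Γ` between levels adjacent in the shift graph are kept. If
large parts of different levels are always joined by an edge (`NoHole`), the most popular colours of
the levels in a `k`-colouring would properly colour the shift graph (`not_colorable_levelGraph`).

Finding such levels is the probabilistic core (`whp_exists_levels`). As all of `X` has at most `ε/p`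
vertices, a typical vertex may see none of it. Each level is therefore cut into `D` blocks of size
`L`, and the next level is chosen among the linearly many vertices with a neighbour in every block
of every earlier level. Conditioned on this, a fixed `1/k`-proportion of a level is missed with
probability at most `exp(-D/k)`, a small constant. Greedy selection with a potential function
(`exists_subset_sum_pow_le`) then handles all large parts at once. Failure is exponentially unlikely
in `n`, which beats a union bound over all placements of at most `√n` vertices.

The neighbourhood `M` of `X` has at most a small multiple of `n` vertices, so the set `B` of
vertices with many neighbours in `M` is small compared with `pn` (`whp_card_le_of_degIn`; here `p ≫
n^(-1/2)` matters). Delete the edges from `X` to `B`, colour `M \ B` by `0`, `B` by `1` and the rest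
by residues, and outside `X` keep only properly coloured edges. Few edges are lost at any vertex
beyond one residue class, and `s`-vertex subgraphs are coloured using `1` and `2` on `X`.

The threshold bound follows with `s` exceeding both `|H|` and a proposed bound on the chromatic
number, up to equality with `|H|`. -/

namespace SparseChromatic

/-! ### Shift graphs: large chromatic number, locally bipartite. -/

/-- `x → y` in the shift digraph: `x` and `y` are the initial and the final segment of a strictly
increasing tuple that is longer by one. -/
def ShiftStep {r N : ℕ} (x y : Fin r → Fin N) : Prop :=
  ∃ z : Fin (r + 1) → Fin N, StrictMono z ∧ x = z ∘ Fin.castSucc ∧ y = z ∘ Fin.succ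

/-- The shift graph on `r`-tuples from `Fin N`. -/
def shiftGraph (r N : ℕ) : SimpleGraph (Fin r → Fin N) := SimpleGraph.fromRel ShiftStep

/-- A tuple is coloured by the set of colours of its one-entry extensions. If `z` witnesses `x → y`,
the colour of `z` belongs to the set of `x`. If it also came from an extension of `y`, that
extension would be a shift successor of `z` with the same colour. -/
lemma exists_coloring_set_of_coloring {r N : ℕ} {α : Type} (hr : 1 ≤ r)
    (c : (Fin (r + 1) → Fin N) → α) (hc : ∀ x y, ShiftStep x y → c x ≠ c y) :
    ∃ C : (Fin r → Fin N) → Set α, ∀ x y, ShiftStep x y → C x ≠ C y := by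
  refine ⟨fun x => {a | ∃ w, StrictMono (Fin.snoc x w : Fin (r + 1) → Fin N) ∧
    c (Fin.snoc x w) = a}, ?_⟩
  rintro x y ⟨z, hz, rfl, rfl⟩ h
  have hsnoc : (Fin.snoc (z ∘ Fin.castSucc) (z (Fin.last r)) : Fin (r + 1) → Fin N) = z :=
    Fin.snoc_init_self z
  have hmem : c z ∈ {a | ∃ w, StrictMono (Fin.snoc (z ∘ Fin.succ) w : Fin (r + 1) → Fin N) ∧
      c (Fin.snoc (z ∘ Fin.succ) w) = a} := by
    beta_reduce at h
    rw [← h]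
    exact ⟨z (Fin.last r), by rwa [hsnoc], by rw [hsnoc]⟩
  obtain ⟨w, hw, hcw⟩ := hmem
  refine hc z (Fin.snoc (z ∘ Fin.succ) w) ⟨Fin.snoc z w, ?_, ?_, ?_⟩ hcw.symm
  · rw [Fin.strictMono_iff_lt_succ]
    intro i
    refine Fin.lastCases ?_ (fun j => ?_) i
    · rw [Fin.succ_last, Fin.snoc_last, Fin.snoc_castSucc]
      obtain ⟨r, rfl⟩ : ∃ r', r = r' + 1 := ⟨r - 1, by omega⟩
      have := hw (Fin.castSucc_lt_last (Fin.last r))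
      rw [Fin.snoc_castSucc, Fin.snoc_last] at this
      simpa using this
    · rw [Fin.succ_castSucc, Fin.snoc_castSucc, Fin.snoc_castSucc]
      exact hz Fin.castSucc_lt_succ
  · funext i; simp
  · funext i
    refine Fin.lastCases ?_ (fun j => ?_) i
    · simp
    · simp only [Function.comp_apply, Fin.succ_castSucc, Fin.snoc_castSucc]

/-- Shortening the tuples by one replaces the colours by sets of colours, still finitely many. For
tuples of length one the statement is the pigeonhole principle. -/
lemma exists_no_shift_coloring (r : ℕ) : ∀ (α : Type) [Finite α], ∃ N : ℕ,
    ∀ c : (Fin (r + 1) → Fin N) → α, ∃ x y, ShiftStep x y ∧ c x = c y := by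
  induction r with
  | zero =>
    intro α _
    refine ⟨Nat.card α + 1, fun c => ?_⟩
    have : ¬ Function.Injective (fun i : Fin (Nat.card α + 1) => c (fun _ => i)) := by
      intro h
      have := Nat.card_le_card_of_injective _ h
      simp at this
    simp only [Function.Injective, not_forall] at this
    obtain ⟨a, b, hab, hne⟩ := this
    rcases lt_or_gt_of_ne hne with h | h
    · refine ⟨_, _, ⟨![a, b], ?_, ?_, ?_⟩, hab⟩
      · simpa [Fin.strictMono_iff_lt_succ] using h
      · funext i; fin_cases i; rfl
      · funext i; fin_cases i; rfl
    · refine ⟨_, _, ⟨![b, a], ?_, ?_, ?_⟩, hab.symm⟩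
      · simpa [Fin.strictMono_iff_lt_succ] using h
      · funext i; fin_cases i; rfl
      · funext i; fin_cases i; rfl
  | succ r ih =>
    intro α _
    obtain ⟨N, hN⟩ := ih (Set α)
    refine ⟨N, fun c => ?_⟩
    by_contra! hc
    obtain ⟨C, hC⟩ := exists_coloring_set_of_coloring (by omega) c hc
    obtain ⟨x, y, hxy, h⟩ := hN C
    exact hC x y hxy h

lemma ShiftStep.ne {r N : ℕ} {x y : Fin (r + 1) → Fin N} (h : ShiftStep x y) : x ≠ y := by
  obtain ⟨z, hz, rfl, rfl⟩ := h
  intro h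
  exact absurd (congrFun h 0) (hz Fin.castSucc_lt_succ).ne

lemma exists_not_colorable_shiftGraph (r k : ℕ) :
    ∃ N, ¬ (shiftGraph (r + 1) N).Colorable k := by
  obtain ⟨N, hN⟩ := exists_no_shift_coloring r (Fin k)
  refine ⟨N, fun ⟨c⟩ => ?_⟩
  obtain ⟨x, y, hxy, h⟩ := hN c
  exact c.valid (show (shiftGraph (r + 1) N).Adj x y from ⟨hxy.ne, Or.inl hxy⟩) h

lemma ShiftStep.apply_eq {r N : ℕ} {x y : Fin r → Fin N} (h : ShiftStep x y) {i : ℕ}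
    (hi : i + 1 < r) : x ⟨i + 1, hi⟩ = y ⟨i, by omega⟩ := by
  obtain ⟨z, hz, rfl, rfl⟩ := h
  rfl

lemma ShiftStep.position {r N : ℕ} {x y : Fin r → Fin N} (h : ShiftStep x y) {i j : Fin r}
    (hij : x i = y j) : (i : ℕ) = j + 1 := by
  obtain ⟨z, hz, rfl, rfl⟩ := h
  have := hz.injective hij
  simpa [Fin.ext_iff] using this

/-- Each step of the walk moves an entry by one position, so an entry farther from both ends than
the walk can carry it survives. -/
lemma exists_position_of_walk {S : Type*} {H : SimpleGraph S} {r N : ℕ} {f : S → Fin r → Fin N}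
    (hf : ∀ a b, H.Adj a b → (shiftGraph r N).Adj (f a) (f b)) {a b : S} (w : H.Walk a b) :
    ∀ (i : ℕ) (hi : i + w.length < r), w.length ≤ i →
      ∃ j : Fin r, f b j = f a ⟨i, by omega⟩ := by
  induction w with
  | nil => exact fun i hi _ => ⟨_, rfl⟩
  | @cons a a' b hadj w ih =>
    intro i hi hle
    rw [SimpleGraph.Walk.length_cons] at hi hle
    rcases (hf _ _ hadj).2 with h | h
    · obtain ⟨i, rfl⟩ : ∃ i', i = i' + 1 := ⟨i - 1, by omega⟩
      rw [h.apply_eq]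
      exact ih i (by omega) (by omega)
    · rw [← h.apply_eq (i := i) (by omega)]
      exact ih (i + 1) (by omega) (by omega)

/-- A graph on at most `s` vertices with a homomorphism to the shift graph on tuples of length
`2 * s + 1` is bipartite: all tuples of one component share a value, and adjacent tuples contain
it at positions of different parity. -/
lemma colorable_two_of_hom_shiftGraph {S : Type*} [Finite S] {H : SimpleGraph S} {s N : ℕ}
    (hS : Nat.card S ≤ s) (f : S → Fin (2 * s + 1) → Fin N)
    (hf : ∀ a b, H.Adj a b → (shiftGraph (2 * s + 1) N).Adj (f a) (f b)) : H.Colorable 2 := by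
  classical
  have := Fintype.ofFinite S
  -- Index `s` is the middle of the tuple, and a path has length less than `s`, so the middle entry
  -- of a component's representative reaches every tuple of that component.
  have hpos : ∀ v, ∃ j : Fin (2 * s + 1),
      f v j = f (H.connectedComponentMk v).out ⟨s, by omega⟩ := by
    intro v
    obtain ⟨w⟩ : H.Reachable (H.connectedComponentMk v).out v :=
      SimpleGraph.ConnectedComponent.exact (Quot.out_eq _)
    have hlen := w.bypass_isPath.length_lt
    rw [Nat.card_eq_fintype_card] at hS
    exact exists_position_of_walk hf w.bypass s (by omega) (by omega)
  choose pos hpos using hpos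
  have key : ∀ v w, ShiftStep (f v) (f w) → H.Adj v w → (pos v : ℕ) = pos w + 1 := by
    intro v w h hadj
    refine h.position ?_
    rw [hpos, hpos, SimpleGraph.ConnectedComponent.sound hadj.reachable]
  refine ⟨SimpleGraph.Coloring.mk (fun v => (⟨(pos v : ℕ) % 2, by omega⟩ : Fin 2)) ?_⟩
  intro v w hadj h
  simp only [Fin.mk.injEq] at h
  rcases (hf _ _ hadj).2 with h' | h'
  · have := key v w h' hadj; omega
  · have := key w v h' hadj.symm; omega

open MeasureTheory ProbabilityTheory SimpleGraph

/-! ### Independence of the edges of the binomial random graph. -/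

section Independence

/-- `f` is determined by the edges of its argument that lie in `A`. -/
def DependsOnEdges {V β : Type*} (f : SimpleGraph V → β) (A : Finset (Sym2 V)) : Prop :=
  ∀ Γ Γ' : SimpleGraph V, (∀ e ∈ A, e ∈ Γ.edgeSet ↔ e ∈ Γ'.edgeSet) → f Γ = f Γ'

variable {V : Type*} [Finite V]

/-- With this, every map from the finite type of graphs is measurable. -/
instance : MeasurableSingletonClass (SimpleGraph V) where
  measurableSet_singleton Γ := by
    have : ({Γ} : Set (SimpleGraph V)) = SimpleGraph.edgeSet ⁻¹' {Γ.edgeSet} := by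
      ext Γ'; simp
    rw [this]
    refine SimpleGraph.measurable_edgeSet ?_
    have : ({Γ.edgeSet} : Set (Set (Sym2 V))) = ⋂ e, {t | e ∈ t ↔ e ∈ Γ.edgeSet} := by
      ext t; simp [Set.ext_iff]
    rw [this]
    refine MeasurableSet.iInter fun e => ?_
    by_cases h : e ∈ Γ.edgeSet
    · simpa [h] using (measurable_set_mem e).setOf
    · simpa [h] using (measurable_set_mem e).not.setOf

lemma binomialRandom_eq_map_infinitePi (p : unitInterval) :
    binomialRandom V p = Measure.map (fun ω : Sym2 V → Prop => fromEdgeSet {e | ω e})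
      (Measure.infinitePi fun e : Sym2 V => unitInterval.toNNReal p • Measure.dirac
        (e ∈ (Sym2.diagSetᶜ : Set (Sym2 V))) +
        unitInterval.toNNReal (unitInterval.symm p) • Measure.dirac False) := by
  rw [binomialRandom_eq_map, setBernoulli_eq_map, Measure.map_map]
  · rfl
  · fun_prop
  · fun_prop

lemma iIndepFun_mem_edgeSet (p : unitInterval) :
    iIndepFun (fun (e : Sym2 V) (Γ : SimpleGraph V) => e ∈ Γ.edgeSet) (binomialRandom V p) := by
  have hm : ∀ e : Sym2 V, Measurable fun Γ : SimpleGraph V => e ∈ Γ.edgeSet := fun e =>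
    measurable_of_finite _
  have hg : Measurable (fun ω : Sym2 V → Prop => fromEdgeSet {e | ω e}) := by fun_prop
  rw [iIndepFun_iff_map_fun_eq_infinitePi_map hm, binomialRandom_eq_map_infinitePi]
  have := iIndepFun_infinitePi (P := fun e : Sym2 V => unitInterval.toNNReal p • Measure.dirac
        (e ∈ (Sym2.diagSetᶜ : Set (Sym2 V))) +
        unitInterval.toNNReal (unitInterval.symm p) • Measure.dirac False)
      -- `fromEdgeSet` discards loops; the second conjunct makes the coordinate equal to membership
      -- in the edge set on the diagonal too.
      (X := fun (e : Sym2 V) (b : Prop) => b ∧ ¬ e.IsDiag) (fun e => measurable_of_finite _)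
  rw [iIndepFun_iff_map_fun_eq_infinitePi_map (fun e => by fun_prop)] at this
  rw [Measure.map_map (measurable_of_finite _) hg]
  convert this using 2
  · funext ω e
    simp
  · funext e
    rw [Measure.map_map (measurable_of_finite _) hg]
    congr 1
    funext ω
    simp

/-- Each factor is a function of the edge indicators in its own set, and disjoint families of these
are independent. -/
lemma integral_mul_of_dependsOnEdges {p : unitInterval} {f g : SimpleGraph V → ℝ}
    {A B : Finset (Sym2 V)} (hf : DependsOnEdges f A) (hg : DependsOnEdges g B)
    (hAB : Disjoint A B) :
    ∫ Γ, f Γ * g Γ ∂binomialRandom V p =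
      (∫ Γ, f Γ ∂binomialRandom V p) * ∫ Γ, g Γ ∂binomialRandom V p := by
  have key := (iIndepFun_mem_edgeSet (V := V) p).indepFun_finset A B hAB
    (fun e => measurable_of_finite _)
  have ext_of : ∀ {h : SimpleGraph V → ℝ} {C : Finset (Sym2 V)}, DependsOnEdges h C →
      ∃ h' : (C → Prop) → ℝ, h = h' ∘ fun Γ (e : C) => (e : Sym2 V) ∈ Γ.edgeSet := by
    intro h C hh
    refine ⟨Function.extend (fun Γ (e : C) => (e : Sym2 V) ∈ Γ.edgeSet) h 0, ?_⟩
    funext Γ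
    refine (Function.FactorsThrough.extend_apply ?_ _ _).symm
    intro Γ₁ Γ₂ h12
    exact hh _ _ fun e he => iff_of_eq (congrFun h12 ⟨e, he⟩)
  obtain ⟨f', hf'⟩ := ext_of hf
  obtain ⟨g', hg'⟩ := ext_of hg
  have := key.comp (φ := f') (ψ := g') (measurable_of_finite _) (measurable_of_finite _)
  rw [← hf', ← hg'] at this
  exact this.integral_mul_eq_mul_integral (measurable_of_finite _).aestronglyMeasurable
    (measurable_of_finite _).aestronglyMeasurable

lemma integral_prod_of_dependsOnEdges {p : unitInterval} {κ : Type*} (U : Finset κ)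
    {f : κ → SimpleGraph V → ℝ} {A : κ → Finset (Sym2 V)} (hf : ∀ v ∈ U, DependsOnEdges (f v) (A v))
    (hA : ∀ v ∈ U, ∀ w ∈ U, v ≠ w → Disjoint (A v) (A w)) :
    ∫ Γ, ∏ v ∈ U, f v Γ ∂binomialRandom V p = ∏ v ∈ U, ∫ Γ, f v Γ ∂binomialRandom V p := by
  classical
  induction U using Finset.induction_on with
  | empty => simp
  | insert a U ha ih =>
    simp only [Finset.prod_insert ha]
    rw [← ih (fun v hv => hf v (Finset.mem_insert_of_mem hv)) (fun v hv w hw =>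
      hA v (Finset.mem_insert_of_mem hv) w (Finset.mem_insert_of_mem hw))]
    refine integral_mul_of_dependsOnEdges (B := U.biUnion A)
      (hf a (Finset.mem_insert_self _ _)) ?_ ?_
    · intro Γ Γ' h
      refine Finset.prod_congr rfl fun v hv => hf v (Finset.mem_insert_of_mem hv) _ _ fun e he => ?_
      exact h e (Finset.mem_biUnion.2 ⟨v, hv, he⟩)
    · rw [Finset.disjoint_biUnion_right]
      intro v hv
      exact hA _ (Finset.mem_insert_self _ _) _ (Finset.mem_insert_of_mem hv)
        (fun h => ha (h ▸ hv))

lemma measureReal_mem_edgeSet (p : unitInterval) {e : Sym2 V} (he : ¬ e.IsDiag) :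
    (binomialRandom V p).real {Γ | e ∈ Γ.edgeSet} = p := by
  have hg : Measurable (fun ω : Sym2 V → Prop => fromEdgeSet {e | ω e}) := by fun_prop
  rw [binomialRandom_eq_map_infinitePi, map_measureReal_apply hg (Set.toFinite _).measurableSet]
  have : (fun ω : Sym2 V → Prop => fromEdgeSet {e | ω e}) ⁻¹' {Γ | e ∈ Γ.edgeSet} =
      (fun ω : Sym2 V → Prop => ω e) ⁻¹' {True} := by
    ext ω; simp [he]
  rw [this, ← map_measureReal_apply (by fun_prop) (Set.toFinite _).measurableSet,
    Measure.infinitePi_map_eval]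
  simp [measureReal_def, he]

end Independence

/-! ### Chernoff bounds for counts of independent events. -/

section Chernoff

variable {V : Type*} [Finite V]

lemma integrable_binomialRandom {p : unitInterval} (f : SimpleGraph V → ℝ) :
    Integrable f (binomialRandom V p) := Integrable.of_finite

lemma integral_ite_binomialRandom {p : unitInterval} (P : SimpleGraph V → Prop)
    [DecidablePred P] (a b : ℝ) :
    ∫ Γ, (if P Γ then a else b) ∂binomialRandom V p =
      b + (a - b) * (binomialRandom V p).real {Γ | P Γ} := by
  have : (fun Γ => if P Γ then a else b) =
      fun Γ => b + Set.indicator {Γ | P Γ} (fun _ => a - b) Γ := by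
    funext Γ
    by_cases h : P Γ <;> simp [h, Set.indicator]
  rw [this, integral_add (integrable_binomialRandom _) (integrable_binomialRandom _),
    integral_indicator (Set.toFinite _).measurableSet]
  simp [mul_comm]

lemma measureReal_le_integral {p : unitInterval} {P : SimpleGraph V → Prop}
    {f : SimpleGraph V → ℝ} (hf : ∀ Γ, 0 ≤ f Γ) (hP : ∀ Γ, P Γ → 1 ≤ f Γ) :
    (binomialRandom V p).real {Γ | P Γ} ≤ ∫ Γ, f Γ ∂binomialRandom V p := by
  classical
  have h := integral_ite_binomialRandom (p := p) P 1 0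
  rw [sub_zero, one_mul, zero_add] at h
  rw [← h]
  refine integral_mono (integrable_binomialRandom _) (integrable_binomialRandom _) fun Γ => ?_
  by_cases hΓ : P Γ
  · simpa [hΓ] using hP Γ hΓ
  · simpa [hΓ] using hf Γ

variable {κ : Type*} {U : Finset κ} {Ev : κ → SimpleGraph V → Prop} {A : κ → Finset (Sym2 V)}
  {p : unitInterval}

lemma integral_exp_card_filter [∀ Γ, DecidablePred fun v => Ev v Γ]
    (hEv : ∀ v ∈ U, DependsOnEdges (Ev v) (A v))
    (hA : ∀ v ∈ U, ∀ w ∈ U, v ≠ w → Disjoint (A v) (A w)) (t : ℝ) :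
    ∫ Γ, Real.exp (t * ({v ∈ U | Ev v Γ}.card : ℝ)) ∂binomialRandom V p =
      ∏ v ∈ U, (1 + (Real.exp t - 1) * (binomialRandom V p).real {Γ | Ev v Γ}) := by
  have : (fun Γ => Real.exp (t * ({v ∈ U | Ev v Γ}.card : ℝ))) =
      fun Γ => ∏ v ∈ U, if Ev v Γ then Real.exp t else 1 := by
    funext Γ
    rw [Finset.prod_ite, Finset.prod_const, Finset.prod_const_one, mul_one, ← Real.exp_nat_mul,
      mul_comm]
  rw [this, integral_prod_of_dependsOnEdges (A := A) U _ hA]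
  · classical
    refine Finset.prod_congr rfl fun v _ => ?_
    rw [← integral_ite_binomialRandom]
  · intro v hv Γ Γ' h
    simp only [hEv v hv Γ Γ' h]

/-- Exponential moment at parameter `1`, with `e - 1 ≤ 2`. It is useful once `a` exceeds twice the
bound on the mean. -/
lemma measureReal_le_card_filter [∀ Γ, DecidablePred fun v => Ev v Γ]
    (hEv : ∀ v ∈ U, DependsOnEdges (Ev v) (A v))
    (hA : ∀ v ∈ U, ∀ w ∈ U, v ≠ w → Disjoint (A v) (A w)) {q : ℝ}
    (hq : ∀ v ∈ U, (binomialRandom V p).real {Γ | Ev v Γ} ≤ q) (a : ℝ) :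
    (binomialRandom V p).real {Γ | a ≤ ({v ∈ U | Ev v Γ}.card : ℝ)} ≤
      Real.exp (2 * q * U.card - a) := by
  have h1 : (binomialRandom V p).real {Γ | a ≤ ({v ∈ U | Ev v Γ}.card : ℝ)} ≤
      ∫ Γ, Real.exp (-a) * Real.exp (1 * ({v ∈ U | Ev v Γ}.card : ℝ)) ∂binomialRandom V p := by
    refine measureReal_le_integral (fun Γ => by positivity) fun Γ hΓ => ?_
    rw [← Real.exp_add]
    exact Real.one_le_exp (by linarith)
  refine h1.trans ?_
  rw [integral_const_mul, integral_exp_card_filter hEv hA, sub_eq_neg_add (2 * q * _),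
    Real.exp_add]
  refine mul_le_mul_of_nonneg_left ?_ (Real.exp_pos _).le
  have he : Real.exp 1 - 1 ≤ 2 := by have := Real.exp_one_lt_d9; linarith
  have he0 : 0 ≤ Real.exp 1 - 1 := by have := Real.add_one_le_exp 1; linarith
  have : ∏ v ∈ U, (1 + (Real.exp 1 - 1) * (binomialRandom V p).real {Γ | Ev v Γ}) ≤
      ∏ _v ∈ U, Real.exp (2 * q) := by
    refine Finset.prod_le_prod (fun v hv => ?_) fun v hv => ?_
    · positivity
    · have h2 := Real.add_one_le_exp (2 * q)
      have h3 := hq v hv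
      have h4 : 0 ≤ (binomialRandom V p).real {Γ | Ev v Γ} := measureReal_nonneg
      nlinarith
  refine this.trans ?_
  rw [Finset.prod_const, ← Real.exp_nat_mul]
  apply le_of_eq; congr 1; ring

/-- The parameter `t` stays free: `t = 1` suffices for losing half of the mean, while small `t`
gives the sharp degree bounds. -/
lemma measureReal_card_filter_le [∀ Γ, DecidablePred fun v => Ev v Γ]
    (hEv : ∀ v ∈ U, DependsOnEdges (Ev v) (A v))
    (hA : ∀ v ∈ U, ∀ w ∈ U, v ≠ w → Disjoint (A v) (A w)) {q : ℝ}
    (hq : ∀ v ∈ U, q ≤ (binomialRandom V p).real {Γ | Ev v Γ}) (a : ℝ) {t : ℝ} (ht : 0 ≤ t) :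
    (binomialRandom V p).real {Γ | ({v ∈ U | Ev v Γ}.card : ℝ) ≤ a} ≤
      Real.exp (t * a - (1 - Real.exp (-t)) * q * U.card) := by
  have h1 : (binomialRandom V p).real {Γ | ({v ∈ U | Ev v Γ}.card : ℝ) ≤ a} ≤
      ∫ Γ, Real.exp (t * a) * Real.exp (-t * ({v ∈ U | Ev v Γ}.card : ℝ))
        ∂binomialRandom V p := by
    refine measureReal_le_integral (fun Γ => by positivity) fun Γ hΓ => ?_
    rw [← Real.exp_add]
    refine Real.one_le_exp ?_
    have := mul_le_mul_of_nonneg_left hΓ ht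
    linarith
  refine h1.trans ?_
  rw [integral_const_mul, integral_exp_card_filter hEv hA, sub_eq_add_neg (t * a), Real.exp_add]
  refine mul_le_mul_of_nonneg_left ?_ (Real.exp_pos _).le
  have he : Real.exp (-t) ≤ 1 := Real.exp_le_one_iff.2 (by linarith)
  have : ∏ v ∈ U, (1 + (Real.exp (-t) - 1) * (binomialRandom V p).real {Γ | Ev v Γ}) ≤
      ∏ _v ∈ U, Real.exp (-((1 - Real.exp (-t)) * q)) := by
    refine Finset.prod_le_prod (fun v hv => ?_) fun v hv => ?_
    · have h4 : (binomialRandom V p).real {Γ | Ev v Γ} ≤ 1 := measureReal_le_one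
      have h5 : 0 ≤ (binomialRandom V p).real {Γ | Ev v Γ} := measureReal_nonneg
      have h6 := Real.exp_pos (-t)
      nlinarith
    · have h2 := Real.add_one_le_exp (-((1 - Real.exp (-t)) * q))
      have h3 := hq v hv
      nlinarith
  refine this.trans ?_
  rw [Finset.prod_const, ← Real.exp_nat_mul]
  apply le_of_eq; congr 1; ring

lemma DependsOnEdges.mem_edgeSet {V : Type*} (e : Sym2 V) :
    DependsOnEdges (fun Γ : SimpleGraph V => e ∈ Γ.edgeSet) {e} :=
  fun _ _ h => propext (h e (Finset.mem_singleton_self e))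

/-- Upper tail for the number of edges of the random graph in a given set of pairs. -/
lemma measureReal_le_card_filter_mem_edgeSet {Q : Finset (Sym2 V)}
    [∀ Γ : SimpleGraph V, DecidablePred (· ∈ Γ.edgeSet)] (hQ : ∀ e ∈ Q, ¬ e.IsDiag)
    (a : ℝ) :
    (binomialRandom V p).real {Γ | a ≤ ({e ∈ Q | e ∈ Γ.edgeSet}.card : ℝ)} ≤
      Real.exp (2 * p * Q.card - a) :=
  measureReal_le_card_filter (A := fun e => {e}) (fun e _ => DependsOnEdges.mem_edgeSet e)
    (fun _ _ _ _ h => by simpa using h) (fun e he => (measureReal_mem_edgeSet p (hQ e he)).le) a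

/-- Lower tail for the number of edges of the random graph in a given set of pairs. -/
lemma measureReal_card_filter_mem_edgeSet_le {Q : Finset (Sym2 V)}
    [∀ Γ : SimpleGraph V, DecidablePred (· ∈ Γ.edgeSet)] (hQ : ∀ e ∈ Q, ¬ e.IsDiag)
    (a : ℝ) {t : ℝ} (ht : 0 ≤ t) :
    (binomialRandom V p).real {Γ | ({e ∈ Q | e ∈ Γ.edgeSet}.card : ℝ) ≤ a} ≤
      Real.exp (t * a - (1 - Real.exp (-t)) * p * Q.card) :=
  measureReal_card_filter_le (A := fun e => {e}) (fun e _ => DependsOnEdges.mem_edgeSet e)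
    (fun _ _ _ _ h => by simpa using h) (fun e he => (measureReal_mem_edgeSet p (hQ e he)).ge) a ht

lemma measureReal_forall_notMem_edgeSet {Q : Finset (Sym2 V)} (hQ : ∀ e ∈ Q, ¬ e.IsDiag) :
    (binomialRandom V p).real {Γ | ∀ e ∈ Q, e ∉ Γ.edgeSet} = (1 - p) ^ Q.card := by
  classical
  have h := integral_ite_binomialRandom (p := p) (fun Γ : SimpleGraph V =>
    ∀ e ∈ Q, e ∉ Γ.edgeSet) 1 0
  rw [sub_zero, one_mul, zero_add] at h
  rw [← h]
  have h2 : (fun Γ : SimpleGraph V => if ∀ e ∈ Q, e ∉ Γ.edgeSet then (1 : ℝ) else 0) =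
      fun Γ => ∏ e ∈ Q, if e ∈ Γ.edgeSet then (0 : ℝ) else 1 := by
    funext Γ
    by_cases hΓ : ∀ e ∈ Q, e ∉ Γ.edgeSet
    · rw [if_pos hΓ]
      exact (Finset.prod_eq_one fun e he => by simp [hΓ e he]).symm
    · rw [if_neg hΓ]
      push Not at hΓ
      obtain ⟨e, he, heΓ⟩ := hΓ
      exact (Finset.prod_eq_zero (i := e) he (by simp [heΓ])).symm
  have h3 : ∫ Γ : SimpleGraph V, (if ∀ e ∈ Q, e ∉ Γ.edgeSet then (1 : ℝ) else 0)
      ∂binomialRandom V p = _ := congrArg (fun f => ∫ Γ, f Γ ∂binomialRandom V p) h2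
  refine Eq.trans ?_ (h3.trans ?_)
  · congr!
  rw [integral_prod_of_dependsOnEdges (A := fun e => {e}) Q]
  · rw [← Finset.prod_const]
    refine Finset.prod_congr rfl fun e he => ?_
    rw [integral_ite_binomialRandom, measureReal_mem_edgeSet p (hQ e he)]
    ring
  · intro e _ Γ Γ' h
    simp only [DependsOnEdges.mem_edgeSet e Γ Γ' h]
  · intro _ _ _ _ h
    simpa using h

end Chernoff

/-! ### Hitting every block while missing prescribed pairs. -/

/-- With `x = 1 - p`: given that some of `L` pairs is an edge, `y` prescribed ones are all absent
with conditional probability at most `exp(-y/L)`. Weighted AM-GM bounds `x^y` by the chord between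
exponents `0` and `L`. -/
lemma pow_sub_pow_le_mul_exp {x : ℝ} (hx0 : 0 ≤ x) (hx1 : x ≤ 1) {y L : ℕ} (hL : 0 < L)
    (hy : y ≤ L) : x ^ y - x ^ L ≤ (1 - x ^ L) * Real.exp (-(y / L : ℝ)) := by
  have hL' : (0 : ℝ) < L := by exact_mod_cast hL
  have hyL : (y : ℝ) / L ≤ 1 := by rw [div_le_one hL']; exact_mod_cast hy
  have h1 := Real.geom_mean_le_arith_mean2_weighted (w₁ := (y : ℝ) / L) (w₂ := 1 - (y : ℝ) / L)
    (p₁ := x ^ L) (p₂ := 1) (by positivity) (by linarith) (by positivity) zero_le_one (by ring)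
  rw [Real.one_rpow, mul_one, ← Real.rpow_natCast x L, ← Real.rpow_mul hx0,
    mul_div_cancel₀ _ hL'.ne', Real.rpow_natCast, Real.rpow_natCast] at h1
  have h2 : x ^ L ≤ 1 := pow_le_one₀ hx0 hx1
  have h3 := Real.add_one_le_exp (-((y : ℝ) / L))
  nlinarith

/-- Since `R i ⊆ Q i`, the indicator for block `i` is that of missing `R i` minus that of missing `Q
i`; distinct blocks are independent. -/
lemma measureReal_forall_hit_and_miss {V κ : Type*} [Finite V] {p : unitInterval} (K : Finset κ)
    {Q R : κ → Finset (Sym2 V)} (hQ : ∀ i ∈ K, ∀ e ∈ Q i, ¬ e.IsDiag) (hRQ : ∀ i ∈ K, R i ⊆ Q i)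
    (hdisj : ∀ i ∈ K, ∀ j ∈ K, i ≠ j → Disjoint (Q i) (Q j)) :
    (binomialRandom V p).real {Γ | ∀ i ∈ K, (∃ e ∈ Q i, e ∈ Γ.edgeSet) ∧
      ∀ e ∈ R i, e ∉ Γ.edgeSet} = ∏ i ∈ K, ((1 - p : ℝ) ^ (R i).card - (1 - p) ^ (Q i).card) := by
  classical
  have h := integral_ite_binomialRandom (p := p) (fun Γ : SimpleGraph V =>
    ∀ i ∈ K, (∃ e ∈ Q i, e ∈ Γ.edgeSet) ∧ ∀ e ∈ R i, e ∉ Γ.edgeSet) 1 0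
  rw [sub_zero, one_mul, zero_add] at h
  rw [← h]
  have h2 : (fun Γ : SimpleGraph V => if ∀ i ∈ K, (∃ e ∈ Q i, e ∈ Γ.edgeSet) ∧
        ∀ e ∈ R i, e ∉ Γ.edgeSet then (1 : ℝ) else 0) =
      fun Γ => ∏ i ∈ K, ((if ∀ e ∈ R i, e ∉ Γ.edgeSet then (1 : ℝ) else 0) -
        if ∀ e ∈ Q i, e ∉ Γ.edgeSet then (1 : ℝ) else 0) := by
    funext Γ
    by_cases hΓ : ∀ i ∈ K, (∃ e ∈ Q i, e ∈ Γ.edgeSet) ∧ ∀ e ∈ R i, e ∉ Γ.edgeSet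
    · rw [if_pos hΓ]
      refine (Finset.prod_eq_one fun i hi => ?_).symm
      rw [if_pos (hΓ i hi).2, if_neg, sub_zero]
      obtain ⟨e, he, he'⟩ := (hΓ i hi).1
      exact fun h => h e he he'
    · rw [if_neg hΓ]
      push Not at hΓ
      obtain ⟨i, hi, hi'⟩ := hΓ
      refine (Finset.prod_eq_zero (i := i) hi ?_).symm
      by_cases hq : ∀ e ∈ Q i, e ∉ Γ.edgeSet
      · rw [if_pos hq, if_pos fun e he => hq e (hRQ i hi he), sub_self]
      · rw [if_neg hq, if_neg, sub_zero]
        push Not at hq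
        obtain ⟨e, he, he'⟩ := hi' hq
        exact fun h => h e he he'
  have h3 := congrArg (fun f => ∫ Γ, f Γ ∂binomialRandom V p) h2
  refine Eq.trans ?_ (h3.trans ?_)
  · congr!
  rw [integral_prod_of_dependsOnEdges (A := Q) K _ hdisj]
  · refine Finset.prod_congr rfl fun i hi => ?_
    rw [integral_sub (integrable_binomialRandom _) (integrable_binomialRandom _),
      integral_ite_binomialRandom, integral_ite_binomialRandom,
      measureReal_forall_notMem_edgeSet fun e he => hQ i hi e (hRQ i hi he),
      measureReal_forall_notMem_edgeSet (hQ i hi)]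
    ring
  · intro i hi Γ Γ' h
    have e1 : (∀ e ∈ R i, e ∉ Γ.edgeSet) ↔ ∀ e ∈ R i, e ∉ Γ'.edgeSet :=
      forall₂_congr fun e he => not_congr (h e (hRQ i hi he))
    have e2 : (∀ e ∈ Q i, e ∉ Γ.edgeSet) ↔ ∀ e ∈ Q i, e ∉ Γ'.edgeSet :=
      forall₂_congr fun e he => not_congr (h e he)
    simp only [e1, e2]

/-! ### Deterministic extension of a system of levels. -/

/-- Greedy selection: from a large set `P` one can choose `t` elements that meet each of the sparse
sets `bad q` rarely, as measured by the potential `∑ q, lam ^ #(R ∩ bad q)`. -/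
lemma exists_subset_sum_pow_le {V Q : Type*} [DecidableEq V] [Fintype Q] {P : Finset V}
    {bad : Q → Finset V} {lam m : ℕ} (hm : 2 * m ≤ P.card)
    (hbad : ∀ q, 2 * (lam * (bad q).card) ≤ P.card) :
    ∀ t ≤ m, ∃ R ⊆ P, R.card = t ∧
      ∑ q, lam ^ (R ∩ bad q).card ≤ 2 ^ t * Fintype.card Q := by
  intro t
  induction t with
  | zero => exact fun _ => ⟨∅, by simp, by simp, by simp⟩
  | succ t ih =>
    intro ht
    obtain ⟨R, hRP, hR, hsum⟩ := ih (by omega)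
    have hcard : (P \ R).card = P.card - t := by rw [Finset.card_sdiff_of_subset hRP, hR]
    have hne : (P \ R).Nonempty := Finset.card_pos.1 (by omega)
    have hle : ∑ v ∈ P \ R, ∑ q, lam ^ (insert v R ∩ bad q).card ≤
        ∑ _v ∈ P \ R, 2 * ∑ q, lam ^ (R ∩ bad q).card := by
      rw [Finset.sum_comm, Finset.sum_const, smul_eq_mul, ← mul_assoc, Finset.mul_sum]
      refine Finset.sum_le_sum fun q _ => ?_
      have h1 : ∀ v ∈ P \ R, lam ^ (insert v R ∩ bad q).card ≤
          lam ^ (R ∩ bad q).card * (1 + if v ∈ bad q then lam else 0) := by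
        intro v hv
        have hvR := (Finset.mem_sdiff.1 hv).2
        by_cases hb : v ∈ bad q
        · rw [Finset.insert_inter_of_mem hb, Finset.card_insert_of_notMem (by simp [hvR]), pow_succ,
            if_pos hb]
          exact Nat.mul_le_mul_left _ (by omega)
        · rw [Finset.insert_inter_of_notMem hb, if_neg hb]
          simp
      refine (Finset.sum_le_sum h1).trans ?_
      rw [← Finset.mul_sum, mul_comm]
      refine Nat.mul_le_mul_right _ ?_
      rw [Finset.sum_add_distrib, Finset.sum_const, smul_eq_mul, mul_one, ← Finset.sum_filter,
        Finset.sum_const, smul_eq_mul]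
      have h2 : ((P \ R).filter (· ∈ bad q)).card ≤ (bad q).card :=
        Finset.card_le_card fun v hv => (Finset.mem_filter.1 hv).2
      have h3 := Nat.mul_le_mul_right lam h2
      have h4 := hbad q
      rw [mul_comm lam] at h4
      omega
    obtain ⟨v, hv, hvle⟩ := Finset.exists_le_of_sum_le hne hle
    have hv' := Finset.mem_sdiff.1 hv
    refine ⟨insert v R, Finset.insert_subset hv'.1 hRP, ?_, hvle.trans ?_⟩
    · rw [Finset.card_insert_of_notMem hv'.2, hR]
    · rw [pow_succ]; nlinarith

/-- Between the levels `φ` and `ψ` there is an edge joining any two parts that make up at least the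
proportion `1 / k` of their levels. -/
def NoHole {V I : Type*} [Fintype I] (Γ : SimpleGraph V) (k : ℕ) (φ ψ : I → V) : Prop :=
  ∀ Y Z : Finset I, Fintype.card I ≤ k * Y.card → Fintype.card I ≤ k * Z.card →
    ∃ y ∈ Y, ∃ z ∈ Z, Γ.Adj (φ y) (ψ z)

lemma NoHole.symm {V I : Type*} [Fintype I] {Γ : SimpleGraph V} {k : ℕ} {φ ψ : I → V}
    (h : NoHole Γ k φ ψ) : NoHole Γ k ψ φ := by
  intro Y Z hY hZ
  obtain ⟨y, hy, z, hz, hyz⟩ := h Z Y hZ hY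
  exact ⟨z, hz, y, hy, hyz.symm⟩

/-- The levels `φ i`, `i ∈ J`, can be extended by one more level without holes. -/
def CanExtend {F V I : Type*} [Fintype I] (Γ : SimpleGraph V) (k : ℕ) (J : Finset F)
    (φ : F → I → V) : Prop :=
  ∃ ψ : I → V, Function.Injective ψ ∧ (∀ i ∈ J, ∀ a b, φ i a ≠ ψ b) ∧ ∀ i ∈ J, NoHole Γ k (φ i) ψ

open Classical in
-- Greedy selection runs over all pairs of a level and a large part `Y`, the bad vertices being
-- those with no neighbour in `Y`. With `m` the level size, a hole would put at least `m/k` chosen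
-- vertices in one bad set. The potential bound then gives `(2 * (4T)^k)^m ≤ (4T)^(mk)`, which is
-- false because of the factor `2^m`.
lemma canExtend_of_card_le {F V I : Type*} [Fintype F] [Fintype I] [Nonempty I]
    {Γ : SimpleGraph V} {k : ℕ} {J : Finset F} {φ : F → I → V} {P : Finset V}
    (hPφ : ∀ i ∈ J, ∀ a, φ i a ∉ P) (hP : 2 * Fintype.card I ≤ P.card)
    (hbad : ∀ i ∈ J, ∀ Y : Finset I, Fintype.card I ≤ k * Y.card →
      2 * (2 * (4 * Fintype.card F) ^ k * {v ∈ P | ∀ y ∈ Y, ¬ Γ.Adj v (φ i y)}.card) ≤ P.card) :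
    CanExtend Γ k J φ := by
  set m := Fintype.card I with hm
  set T := Fintype.card F with hT
  have hm0 : 1 ≤ m := Fintype.card_pos
  obtain ⟨R, hRP, hR, hsum⟩ := exists_subset_sum_pow_le (Q := F × Finset I) (P := P)
    (bad := fun q => if q.1 ∈ J ∧ m ≤ k * q.2.card then
      {v ∈ P | ∀ y ∈ q.2, ¬ Γ.Adj v (φ q.1 y)} else ∅) (lam := 2 * (4 * T) ^ k) hP
    (by
      rintro ⟨i, Y⟩
      by_cases h : i ∈ J ∧ m ≤ k * Y.card
      · simp only [h, and_self, if_true]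
        exact hbad i h.1 Y h.2
      · simp only [if_neg h]
        simp) m le_rfl
  have hcard : Fintype.card I = Fintype.card R := by rw [Fintype.card_coe, hR]
  let e := Fintype.equivOfCardEq hcard
  refine ⟨fun a => e a, Subtype.val_injective.comp e.injective, ?_, ?_⟩
  · intro i hi a b h
    exact hPφ i hi a (h ▸ hRP (e b).2)
  · intro i hi Y Z hY hZ
    by_contra! hno
    have hT1 : 1 ≤ T := Fintype.card_pos_iff.2 ⟨i⟩
    have hZb : Z.card ≤ (R ∩ {v ∈ P | ∀ y ∈ Y, ¬ Γ.Adj v (φ i y)}).card := by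
      refine Finset.card_le_card_of_injOn (fun z => (e z : V)) ?_
        (Subtype.val_injective.comp e.injective).injOn
      intro z hz
      simp only [Finset.coe_inter, Set.mem_inter_iff, Finset.mem_coe, Finset.mem_filter]
      exact ⟨(e z).2, hRP (e z).2, fun y hy h => hno y hy z hz h.symm⟩
    have h1 := (Finset.single_le_sum (fun q _ => Nat.zero_le _)
      (Finset.mem_univ ((i, Y) : F × Finset I))).trans hsum
    rw [if_pos ⟨hi, hY⟩, Fintype.card_prod, Fintype.card_finset] at h1
    set b := (R ∩ {v ∈ P | ∀ y ∈ Y, ¬ Γ.Adj v (φ i y)}).card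
    have h2 : m ≤ b * k := by
      rw [mul_comm]; exact hZ.trans (Nat.mul_le_mul_left _ hZb)
    have hlam : 1 ≤ 2 * (4 * T) ^ k := by
      have : 0 < (4 * T) ^ k := by positivity
      omega
    have h3 : (2 * (4 * T) ^ k) ^ m ≤ (2 ^ m * (T * 2 ^ m)) ^ k :=
      calc (2 * (4 * T) ^ k) ^ m ≤ (2 * (4 * T) ^ k) ^ (b * k) := Nat.pow_le_pow_right hlam h2
        _ = ((2 * (4 * T) ^ k) ^ b) ^ k := pow_mul _ _ _
        _ ≤ _ := Nat.pow_le_pow_left h1 k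
    have h4 : 2 ^ m * (T * 2 ^ m) ≤ (4 * T) ^ m :=
      calc 2 ^ m * (T * 2 ^ m) = (2 * 2) ^ m * T := by rw [mul_pow]; ring
        _ ≤ (2 * 2) ^ m * T ^ m := Nat.mul_le_mul_left _ (Nat.le_self_pow (by omega) T)
        _ = (4 * T) ^ m := by rw [← mul_pow]
    have h5 := h3.trans (Nat.pow_le_pow_left h4 k)
    rw [mul_pow, ← pow_mul, ← pow_mul, mul_comm k m] at h5
    have h6 : 0 < (4 * T) ^ (m * k) := by positivity
    have h7 : 2 ≤ 2 ^ m := Nat.le_self_pow (by omega) 2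
    nlinarith

/-! ### Stars from a vertex to the blocks of the levels. -/

section Stars

variable {F V : Type*} {D L : ℕ}

/-- The pairs joining `v` to the part `κ.2` of the level `κ.1`. -/
def starPart [DecidableEq V] (φ : F → Fin D × Fin L → V) (v : V) (κ : F × Fin D) :
    Finset (Sym2 V) :=
  Finset.univ.image fun l => s(v, φ κ.1 (κ.2, l))

open Classical in
/-- The pairs joining `v` to the members of `Y` in the part `κ.2` of the level `κ.1`, if this is
the level `i`. -/
noncomputable def starSubpart (φ : F → Fin D × Fin L → V) (i : F)
    (Y : Finset (Fin D × Fin L)) (v : V) (κ : F × Fin D) : Finset (Sym2 V) :=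
  if κ.1 = i then (Finset.univ.filter fun l => (κ.2, l) ∈ Y).image fun l => s(v, φ κ.1 (κ.2, l)) else ∅

variable {φ : F → Fin D × Fin L → V} {J : Finset F}

open Classical in
lemma starSubpart_subset (i : F) (Y : Finset (Fin D × Fin L)) (v : V) (κ : F × Fin D) :
    starSubpart φ i Y v κ ⊆ starPart φ v κ := by
  unfold starSubpart starPart
  split_ifs
  · exact Finset.image_subset_image (Finset.subset_univ _)
  · exact Finset.empty_subset _

open Classical in
lemma card_starPart (hφ : ∀ i ∈ J, ∀ j ∈ J, ∀ a b, φ i a = φ j b → i = j ∧ a = b)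
    (v : V) {κ : F × Fin D} (hκ : κ.1 ∈ J) : (starPart φ v κ).card = L := by
  unfold starPart
  rw [Finset.card_image_of_injective, Finset.card_univ, Fintype.card_fin]
  intro l l' h
  have := (hφ _ hκ _ hκ _ _ (Sym2.congr_right.1 h)).2
  simpa using this

open Classical in
lemma sum_card_starSubpart (hφ : ∀ i ∈ J, ∀ j ∈ J, ∀ a b, φ i a = φ j b → i = j ∧ a = b)
    (v : V) {i : F} (hi : i ∈ J) (Y : Finset (Fin D × Fin L)) :
    ∑ κ ∈ J ×ˢ (Finset.univ : Finset (Fin D)), (starSubpart φ i Y v κ).card = Y.card := by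
  rw [Finset.sum_product, Finset.sum_eq_single_of_mem i hi]
  · have : ∀ d, (starSubpart φ i Y v (i, d)).card = (Finset.univ.filter fun l => (d, l) ∈ Y).card := by
      intro d
      unfold starSubpart
      rw [if_pos rfl, Finset.card_image_of_injective]
      · intro l l' h
        have := (hφ _ hi _ hi _ _ (Sym2.congr_right.1 h)).2
        simpa using this
    simp only [this]
    rw [← Finset.card_sigma]
    refine Finset.card_bij (fun x _ => (x.1, x.2)) ?_ ?_ ?_
    · rintro ⟨d, l⟩ h; simpa using h
    · rintro ⟨d, l⟩ _ ⟨d', l'⟩ _ h; simpa using h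
    · rintro ⟨d, l⟩ h; exact ⟨⟨d, l⟩, by simpa using h, rfl⟩
  · intro j _ hj
    refine Finset.sum_eq_zero fun d _ => ?_
    simp [starSubpart, hj]

open Classical in
lemma disjoint_starPart (hφ : ∀ i ∈ J, ∀ j ∈ J, ∀ a b, φ i a = φ j b → i = j ∧ a = b)
    {v w : V} (hw : ∀ i ∈ J, ∀ a, φ i a ≠ w)
    {κ κ' : F × Fin D} (hκ : κ.1 ∈ J) (hκ' : κ'.1 ∈ J) (h : v ≠ w ∨ κ ≠ κ') :
    Disjoint (starPart φ v κ) (starPart φ w κ') := by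
  rw [Finset.disjoint_left]
  intro e he he'
  simp only [starPart, Finset.mem_image, Finset.mem_univ, true_and] at he he'
  obtain ⟨l, rfl⟩ := he
  obtain ⟨l', hl'⟩ := he'
  rw [Sym2.eq_iff] at hl'
  rcases hl' with ⟨h1, h2⟩ | ⟨h1, h2⟩
  · have := hφ _ hκ' _ hκ _ _ h2
    rcases h with h | h
    · exact h h1.symm
    · refine h (Prod.ext this.1.symm ?_)
      have := this.2
      simp only [Prod.mk.injEq] at this
      exact this.1.symm
  · exact hw _ hκ _ h1.symm

/-- The event that `v` has a neighbour in each part of each level, but none in the part `Y` of the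
level `i`. -/
def HitsAvoiding (φ : F → Fin D × Fin L → V) (J : Finset F) (i : F)
    (Y : Finset (Fin D × Fin L)) (v : V) (Γ : SimpleGraph V) : Prop :=
  (∀ j ∈ J, ∀ d, ∃ l, Γ.Adj v (φ j (d, l))) ∧ ∀ y ∈ Y, ¬ Γ.Adj v (φ i y)

open Classical in
lemma hitsAvoiding_iff {i : F} (hi : i ∈ J) {Y : Finset (Fin D × Fin L)} {v : V}
    {Γ : SimpleGraph V} : HitsAvoiding φ J i Y v Γ ↔
      ∀ κ ∈ J ×ˢ (Finset.univ : Finset (Fin D)), (∃ e ∈ starPart φ v κ, e ∈ Γ.edgeSet) ∧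
        ∀ e ∈ starSubpart φ i Y v κ, e ∉ Γ.edgeSet := by
  constructor
  · rintro ⟨h1, h2⟩ ⟨j, d⟩ hκ
    simp only [Finset.mem_product, Finset.mem_univ, and_true] at hκ
    obtain ⟨l, hl⟩ := h1 j hκ d
    refine ⟨⟨_, Finset.mem_image_of_mem _ (Finset.mem_univ l), hl⟩, ?_⟩
    intro e he
    by_cases hj : j = i
    · subst hj
      simp only [starSubpart, if_true, Finset.mem_image, Finset.mem_filter, Finset.mem_univ,
        true_and] at he
      obtain ⟨l, hl, rfl⟩ := he
      exact h2 _ hl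
    · simp [starSubpart, hj] at he
  · intro h
    refine ⟨fun j hj d => ?_, fun y hy hadj => ?_⟩
    · obtain ⟨e, he, he'⟩ := (h (j, d) (by simp [hj])).1
      simp only [starPart, Finset.mem_image, Finset.mem_univ, true_and] at he
      obtain ⟨l, rfl⟩ := he
      exact ⟨l, he'⟩
    · refine (h (i, y.1) (by simp [hi])).2 s(v, φ i y) ?_ hadj
      simp only [starSubpart, if_true, Finset.mem_image, Finset.mem_filter, Finset.mem_univ,
        true_and]
      exact ⟨y.2, hy, rfl⟩


open Classical in
lemma dependsOnEdges_hitsAvoiding {i : F} (hi : i ∈ J) (Y : Finset (Fin D × Fin L)) (v : V) :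
    DependsOnEdges (HitsAvoiding φ J i Y v)
      ((J ×ˢ (Finset.univ : Finset (Fin D))).biUnion (starPart φ v)) := by
  intro Γ Γ' h
  refine propext ?_
  rw [hitsAvoiding_iff hi, hitsAvoiding_iff hi]
  refine forall₂_congr fun κ hκ => and_congr ?_ ?_
  · refine exists_congr fun e => and_congr_right fun he => ?_
    exact h e (Finset.mem_biUnion.2 ⟨κ, hκ, he⟩)
  · refine forall₂_congr fun e he => not_congr ?_
    exact h e (Finset.mem_biUnion.2 ⟨κ, hκ, starSubpart_subset _ _ _ _ he⟩)

variable [Finite V] {p : unitInterval}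

/-- The conditional bound `pow_sub_pow_le_mul_exp` is applied in each block. The sizes of the pieces
of `Y` add up to `|Y|`, so the exponential factors multiply to `exp(-|Y|/L)`. -/
lemma measureReal_hitsAvoiding_le
    (hφ : ∀ i ∈ J, ∀ j ∈ J, ∀ a b, φ i a = φ j b → i = j ∧ a = b) (hL : 0 < L)
    {v : V} (hv : ∀ i ∈ J, ∀ a, φ i a ≠ v) {i : F} (hi : i ∈ J) (Y : Finset (Fin D × Fin L)) :
    (binomialRandom V p).real {Γ | HitsAvoiding φ J i Y v Γ} ≤
      (1 - (1 - p : ℝ) ^ L) ^ (J.card * D) * Real.exp (-(Y.card / L : ℝ)) := by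
  classical
  have hp0 : (0 : ℝ) ≤ 1 - p := by have := p.2.2; linarith
  have hp1 : (1 - p : ℝ) ≤ 1 := by have := p.2.1; linarith
  simp only [hitsAvoiding_iff hi]
  rw [measureReal_forall_hit_and_miss]
  · have hprod : ∏ κ ∈ J ×ˢ (Finset.univ : Finset (Fin D)),
        ((1 - p : ℝ) ^ (starSubpart φ i Y v κ).card - (1 - p) ^ (starPart φ v κ).card) ≤
        ∏ κ ∈ J ×ˢ (Finset.univ : Finset (Fin D)), ((1 - (1 - p : ℝ) ^ L) *
          Real.exp (-((starSubpart φ i Y v κ).card / L : ℝ))) := by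
      refine Finset.prod_le_prod (fun κ hκ => ?_) fun κ hκ => ?_
      · exact sub_nonneg.2 (pow_le_pow_of_le_one hp0 hp1
          (Finset.card_le_card (starSubpart_subset _ _ _ _)))
      · have hκ' := (Finset.mem_product.1 hκ).1
        have hle := Finset.card_le_card (starSubpart_subset (φ := φ) i Y v κ)
        rw [card_starPart hφ v hκ'] at hle ⊢
        exact pow_sub_pow_le_mul_exp hp0 hp1 hL hle
    refine hprod.trans (le_of_eq ?_)
    rw [Finset.prod_mul_distrib, Finset.prod_const, Finset.card_product, Finset.card_univ,
      Fintype.card_fin, ← Real.exp_sum, Finset.sum_neg_distrib, ← Finset.sum_div,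
      ← sum_card_starSubpart hφ v hi Y]
    push_cast
    rfl
  · rintro κ hκ e he
    simp only [starPart, Finset.mem_image, Finset.mem_univ, true_and] at he
    obtain ⟨l, rfl⟩ := he
    rw [Sym2.mk_isDiag_iff]
    exact fun h => hv _ (Finset.mem_product.1 hκ).1 _ h.symm
  · exact fun κ _ => starSubpart_subset _ _ _ _
  · intro κ hκ κ' hκ' hne
    exact disjoint_starPart hφ hv (Finset.mem_product.1 hκ).1 (Finset.mem_product.1 hκ').1
      (Or.inr hne)

lemma measureReal_hitsAvoiding_empty
    (hφ : ∀ i ∈ J, ∀ j ∈ J, ∀ a b, φ i a = φ j b → i = j ∧ a = b)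
    {v : V} (hv : ∀ i ∈ J, ∀ a, φ i a ≠ v) {i : F} (hi : i ∈ J) :
    (binomialRandom V p).real {Γ | HitsAvoiding φ J i ∅ v Γ} =
      (1 - (1 - p : ℝ) ^ L) ^ (J.card * D) := by
  classical
  simp only [hitsAvoiding_iff hi]
  rw [measureReal_forall_hit_and_miss]
  · rw [Finset.prod_congr rfl (g := fun _ => 1 - (1 - p : ℝ) ^ L), Finset.prod_const,
      Finset.card_product, Finset.card_univ, Fintype.card_fin]
    intro κ hκ
    rw [card_starPart hφ v (Finset.mem_product.1 hκ).1]
    unfold starSubpart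
    split_ifs <;> simp
  · rintro κ hκ e he
    simp only [starPart, Finset.mem_image, Finset.mem_univ, true_and] at he
    obtain ⟨l, rfl⟩ := he
    rw [Sym2.mk_isDiag_iff]
    exact fun h => hv _ (Finset.mem_product.1 hκ).1 _ h.symm
  · exact fun κ _ => starSubpart_subset _ _ _ _
  · intro κ hκ κ' hκ' hne
    exact disjoint_starPart hφ hv (Finset.mem_product.1 hκ).1 (Finset.mem_product.1 hκ').1
      (Or.inr hne)

end Stars

/-! ### From one extension to a full system of levels. -/

/-- The pool consists of the vertices of `U`, outside the levels, that hit every block. It has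
expected size `|U| q` and is at least half as large except with small probability. For each large
`Y`, fewer than `4 |U| q ζ` pool vertices miss it, again up to small probability; the factor `32` in
`hζ` makes this sparse enough for the greedy selection. The factor `2^(DL)` comes from the union
over `Y`. -/
lemma measureReal_not_canExtend_le {F : Type*} [Fintype F] {n D L k : ℕ} {p : unitInterval}
    {J : Finset F} (hJ : J.Nonempty) {φ : F → Fin D × Fin L → Fin n}
    (hφ : ∀ i ∈ J, ∀ j ∈ J, ∀ a b, φ i a = φ j b → i = j ∧ a = b)
    (hD : 0 < D) (hL : 0 < L) (hk : 0 < k) {c : ℝ} (hc : 0 < c) (hcp : c ≤ 1 - (1 - p : ℝ) ^ L)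
    (hζ : 32 * (4 * Fintype.card F : ℝ) ^ k * Real.exp (-(D / k : ℝ)) ≤ 1)
    (hn1 : 2 * (Fintype.card F * (D * L)) ≤ n)
    (hn2 : 8 * (D * L : ℝ) ≤ n * c ^ (Fintype.card F * D)) :
    (binomialRandom (Fin n) p).real {Γ | ¬ CanExtend Γ k J φ} ≤
      (1 + Fintype.card F * 2 ^ (D * L)) *
        Real.exp (-(n * c ^ (Fintype.card F * D) * Real.exp (-(D / k : ℝ)) / 20)) := by
  classical
  obtain ⟨i₀, hi₀⟩ := hJ
  set T := Fintype.card F with hT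
  set ζ := Real.exp (-(D / k : ℝ)) with hζdef
  have hζ0 : 0 < ζ := Real.exp_pos _
  have hζ1 : ζ ≤ 1 := Real.exp_le_one_iff.2 (by have : (0 : ℝ) ≤ D / k := by positivity
                                                linarith)
  have hp0 : (0 : ℝ) ≤ 1 - p := by have := p.2.2; linarith
  have hp1 : (1 - p : ℝ) ≤ 1 := by have := p.2.1; linarith
  set q : ℝ := (1 - (1 - p : ℝ) ^ L) ^ (J.card * D) with hq
  have hc1 : c ≤ 1 := hcp.trans (by have : (0 : ℝ) ≤ (1 - p) ^ L := by positivity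
                                    linarith)
  have hqc : c ^ (T * D) ≤ q :=
    (pow_le_pow_of_le_one hc.le hc1 (Nat.mul_le_mul_right D (Finset.card_le_univ J))).trans
      (pow_le_pow_left₀ hc.le hcp _)
  have hq0 : 0 < q := (pow_pos hc _).trans_le hqc
  let U : Finset (Fin n) := {v | ∀ i ∈ J, ∀ a, φ i a ≠ v}
  have hUmem : ∀ v ∈ U, ∀ i ∈ J, ∀ a, φ i a ≠ v := fun v hv => (Finset.mem_filter.1 hv).2
  have hU : (n : ℝ) / 2 ≤ U.card := by
    have h1 : Uᶜ ⊆ (Finset.univ : Finset (F × (Fin D × Fin L))).image fun x => φ x.1 x.2 := by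
      intro v hv
      simp only [U, Finset.mem_compl, Finset.mem_filter, Finset.mem_univ, true_and] at hv
      push Not at hv
      obtain ⟨i, _, a, rfl⟩ := hv
      exact Finset.mem_image.2 ⟨(i, a), Finset.mem_univ _, rfl⟩
    have h2 := (Finset.card_le_card h1).trans Finset.card_image_le
    rw [Finset.card_univ, Fintype.card_prod, Fintype.card_prod, Fintype.card_fin,
      Fintype.card_fin, ← hT] at h2
    have h3 := Finset.card_add_card_compl U
    rw [Fintype.card_fin] at h3
    have h4 : n ≤ 2 * U.card := by omega
    have h5 : (n : ℝ) ≤ 2 * U.card := by exact_mod_cast h4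
    linarith
  have hUq : n * c ^ (T * D) / 2 ≤ U.card * q := by
    have := mul_le_mul hU hqc (by positivity) (by positivity)
    linarith
  -- Vertices of `U` lie on no level, so their stars share no pair and the events are independent.
  have hA : ∀ v ∈ U, ∀ w ∈ U, v ≠ w →
      Disjoint ((J ×ˢ (Finset.univ : Finset (Fin D))).biUnion (starPart φ v))
        ((J ×ˢ (Finset.univ : Finset (Fin D))).biUnion (starPart φ w)) := by
    intro v hv w hw hvw
    rw [Finset.disjoint_biUnion_left]
    intro κ hκ
    rw [Finset.disjoint_biUnion_right]
    intro κ' hκ'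
    have := disjoint_starPart hφ (hUmem w hw) (Finset.mem_product.1 hκ).1
      (Finset.mem_product.1 hκ').1 (Or.inl hvw)
    convert this
  set bound := Real.exp (-(n * c ^ (T * D) * ζ / 20)) with hbound
  have hpool : (binomialRandom (Fin n) p).real
      {Γ | ({v ∈ U | HitsAvoiding φ J i₀ ∅ v Γ}.card : ℝ) ≤ U.card * q / 2} ≤ bound := by
    refine (measureReal_card_filter_le (fun v _ => dependsOnEdges_hitsAvoiding hi₀ ∅ v)
      (by convert hA) (fun v hv => (measureReal_hitsAvoiding_empty hφ (hUmem v hv) hi₀).ge) _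
      zero_le_one).trans ?_
    refine Real.exp_le_exp.2 ?_
    have he : Real.exp (-1) ≤ 0.4 := by
      have := Real.exp_neg_one_lt_d9; linarith
    have h1 : 0 ≤ U.card * q := by positivity
    have h2 : (1 - Real.exp (-1)) * q * U.card ≥ 0.6 * (U.card * q) := by nlinarith
    have h3 : (n : ℝ) * c ^ (T * D) * ζ ≤ n * c ^ (T * D) :=
      mul_le_of_le_one_right (by positivity) hζ1
    linarith
  have hbad : ∀ i ∈ J, ∀ Y : Finset (Fin D × Fin L), D * L ≤ k * Y.card →
      (binomialRandom (Fin n) p).real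
        {Γ | 4 * (U.card * q * ζ) ≤ ({v ∈ U | HitsAvoiding φ J i Y v Γ}.card : ℝ)} ≤ bound := by
    intro i hi Y hY
    have hYζ : Real.exp (-(Y.card / L : ℝ)) ≤ ζ := by
      refine Real.exp_le_exp.2 (neg_le_neg ?_)
      rw [div_le_div_iff₀ (by positivity) (by positivity), mul_comm (Y.card : ℝ)]
      exact_mod_cast hY
    refine (measureReal_le_card_filter (q := q * ζ)
      (fun v _ => dependsOnEdges_hitsAvoiding hi Y v) (by convert hA)
      (fun v hv => (measureReal_hitsAvoiding_le hφ hL (hUmem v hv) hi Y).trans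
        (mul_le_mul_of_nonneg_left hYζ hq0.le)) _).trans ?_
    refine Real.exp_le_exp.2 ?_
    have h1 : n * c ^ (T * D) / 2 * ζ ≤ U.card * q * ζ := mul_le_mul_of_nonneg_right hUq hζ0.le
    have h2 : 0 ≤ U.card * q * ζ := by positivity
    linarith
  have hsub : {Γ : SimpleGraph (Fin n) | ¬ CanExtend Γ k J φ} ⊆
      {Γ | ({v ∈ U | HitsAvoiding φ J i₀ ∅ v Γ}.card : ℝ) ≤ U.card * q / 2} ∪
      ⋃ x ∈ (Finset.univ : Finset (F × Finset (Fin D × Fin L))),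
        {Γ | (x.1 ∈ J ∧ D * L ≤ k * x.2.card) ∧
          4 * (U.card * q * ζ) ≤ ({v ∈ U | HitsAvoiding φ J x.1 x.2 v Γ}.card : ℝ)} := by
    intro Γ hΓ
    by_contra hno
    simp only [Set.mem_union, Set.mem_iUnion, Set.mem_ofPred_eq, not_or, not_exists,
      Finset.mem_univ, not_and, not_le, forall_const, Prod.forall, and_imp] at hno
    obtain ⟨h1, h2⟩ := hno
    refine hΓ ?_
    have : Nonempty (Fin D × Fin L) := ⟨(⟨0, hD⟩, ⟨0, hL⟩)⟩
    refine canExtend_of_card_le (P := {v ∈ U | HitsAvoiding φ J i₀ ∅ v Γ}) ?_ ?_ ?_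
    · intro i hi a h
      exact hUmem _ (Finset.mem_filter.1 h).1 i hi a rfl
    · rw [Fintype.card_prod, Fintype.card_fin, Fintype.card_fin]
      have : (2 * (D * L) : ℝ) ≤ ({v ∈ U | HitsAvoiding φ J i₀ ∅ v Γ}.card : ℝ) := by linarith
      exact_mod_cast this
    · intro i hi Y hY
      rw [Fintype.card_prod, Fintype.card_fin, Fintype.card_fin] at hY
      have h3 := h2 i Y hi hY
      have h4 : ({v ∈ ({v ∈ U | HitsAvoiding φ J i₀ ∅ v Γ} : Finset (Fin n)) |
          ∀ y ∈ Y, ¬ Γ.Adj v (φ i y)}.card : ℝ) ≤ {v ∈ U | HitsAvoiding φ J i Y v Γ}.card := by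
        norm_cast
        refine Finset.card_le_card fun v hv => ?_
        simp only [Finset.mem_filter] at hv ⊢
        exact ⟨hv.1.1, hv.1.2.1, hv.2⟩
      have h5 : (2 * (2 * (4 * T : ℝ) ^ k *
          {v ∈ ({v ∈ U | HitsAvoiding φ J i₀ ∅ v Γ} : Finset (Fin n)) |
            ∀ y ∈ Y, ¬ Γ.Adj v (φ i y)}.card)) ≤ {v ∈ U | HitsAvoiding φ J i₀ ∅ v Γ}.card := by
        have h6 : (0 : ℝ) ≤ (4 * T : ℝ) ^ k := by positivity
        have h7 := mul_le_mul_of_nonneg_left (h4.trans h3.le) h6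
        have h8 : 32 * (4 * T : ℝ) ^ k * ζ * (U.card * q) ≤ 1 * (U.card * q) :=
          mul_le_mul_of_nonneg_right hζ (by positivity)
        linarith
      have hcast : ∀ b P₀ : ℕ, 2 * (2 * (4 * T : ℝ) ^ k * b) ≤ P₀ →
          2 * (2 * (4 * T) ^ k * b) ≤ P₀ := fun b P₀ h => by exact_mod_cast h
      refine hcast _ _ ?_
      convert h5
  refine (measureReal_mono hsub).trans ((measureReal_union_le _ _).trans ?_)
  rw [add_mul, one_mul]
  refine add_le_add hpool ((measureReal_biUnion_finset_le _ _).trans ?_)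
  refine (Finset.sum_le_card_nsmul _ _ bound ?_).trans (le_of_eq ?_)
  · rintro ⟨i, Y⟩ _
    by_cases h : i ∈ J ∧ D * L ≤ k * Y.card
    · simpa only [h, true_and, and_self] using hbad i h.1 Y h.2
    · simp only [h, false_and, Set.ofPred_false, measureReal_empty]
      exact (Real.exp_pos _).le
  · rw [Finset.card_univ, Fintype.card_prod, Fintype.card_finset, Fintype.card_prod,
      Fintype.card_fin, Fintype.card_fin, nsmul_eq_mul]
    push_cast
    rfl

/-- Extendability is assumed for every placement because the levels already built depend on `Γ`;
given this, the induction is deterministic. -/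
lemma exists_levels_of_canExtend {F : Type*} {n k D L : ℕ} {Γ : SimpleGraph (Fin n)}
    (hDL : D * L ≤ n)
    (h : ∀ J : Finset F, J.Nonempty → ∀ φ : F → Fin D × Fin L → Fin n,
      (∀ i ∈ J, ∀ j ∈ J, ∀ a b, φ i a = φ j b → i = j ∧ a = b) → CanExtend Γ k J φ)
    (J : Finset F) : ∃ φ : F → Fin D × Fin L → Fin n,
      (∀ i ∈ J, ∀ j ∈ J, ∀ a b, φ i a = φ j b → i = j ∧ a = b) ∧
      ∀ i ∈ J, ∀ j ∈ J, i ≠ j → NoHole Γ k (φ i) (φ j) := by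
  classical
  obtain ⟨ψ₀⟩ : Nonempty ((Fin D × Fin L) ↪ Fin n) :=
    Function.Embedding.nonempty_of_card_le (by simpa using hDL)
  induction J using Finset.induction_on with
  | empty => exact ⟨fun _ => ψ₀, by simp, by simp⟩
  | insert j₀ J hj₀ ih =>
    obtain ⟨φ, hφ, hole⟩ := ih
    have hext : CanExtend Γ k J φ := by
      rcases J.eq_empty_or_nonempty with rfl | hJ
      · exact ⟨ψ₀, ψ₀.injective, by simp, by simp⟩
      · exact h J hJ φ hφ
    obtain ⟨ψ, hψ, hne, hψhole⟩ := hext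
    have hupd : ∀ i ∈ J, Function.update φ j₀ ψ i = φ i := fun i hi =>
      Function.update_of_ne (fun h : i = j₀ => hj₀ (h ▸ hi)) _ _
    refine ⟨Function.update φ j₀ ψ, ?_, ?_⟩
    · intro i hi j hj a b hab
      rcases Finset.mem_insert.1 hi with rfl | hi' <;>
        rcases Finset.mem_insert.1 hj with rfl | hj'
      · rw [Function.update_self] at hab
        exact ⟨rfl, hψ hab⟩
      · rw [Function.update_self, hupd j hj'] at hab
        exact absurd hab.symm (hne j hj' b a)
      · rw [Function.update_self, hupd i hi'] at hab
        exact absurd hab (hne i hi' a b)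
      · rw [hupd i hi', hupd j hj'] at hab
        exact hφ i hi' j hj' a b hab
    · intro i hi j hj hij
      rcases Finset.mem_insert.1 hi with rfl | hi' <;>
        rcases Finset.mem_insert.1 hj with rfl | hj'
      · exact absurd rfl hij
      · rw [Function.update_self, hupd j hj']
        exact (hψhole j hj').symm
      · rw [Function.update_self, hupd i hi']
        exact hψhole i hi'
      · rw [hupd i hi', hupd j hj']
        exact hole i hi' j hj' hij

/-! ### Calculus of events holding with high probability, and asymptotic estimates. -/

section Whp

variable {p : ℕ → unitInterval} {P Q : (n : ℕ) → SimpleGraph (Fin n) → Prop}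

lemma whp_iff_tendsto_measureReal : Whp p P ↔
    Tendsto (fun n => (binomialRandom (Fin n) (p n)).real {Γ | ¬ P n Γ}) atTop (nhds 0) := by
  have h : ∀ n, (binomialRandom (Fin n) (p n)).real {Γ | ¬ P n Γ} =
      1 - (binomialRandom (Fin n) (p n)).real {Γ | P n Γ} := fun n =>
    probReal_compl_eq_one_sub (Set.toFinite _).measurableSet
  have h1 : Whp p P ↔
      Tendsto (fun n => (binomialRandom (Fin n) (p n)).real {Γ | P n Γ}) atTop (nhds 1) := by
    unfold Whp
    rw [← ENNReal.tendsto_toReal_iff (fun n => measure_ne_top _ _) ENNReal.one_ne_top]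
    rfl
  rw [h1]
  simp only [h]
  constructor
  · intro h2
    simpa using h2.const_sub 1
  · intro h2
    simpa using h2.const_sub 1

lemma whp_of_measureReal_le {f : ℕ → ℝ} (hf : Tendsto f atTop (nhds 0))
    (h : ∀ᶠ n in atTop, (binomialRandom (Fin n) (p n)).real {Γ | ¬ P n Γ} ≤ f n) : Whp p P :=
  whp_iff_tendsto_measureReal.2 (squeeze_zero' (.of_forall fun _ => measureReal_nonneg) h hf)

lemma Whp.mono (hP : Whp p P) (h : ∀ᶠ n in atTop, ∀ Γ, P n Γ → Q n Γ) : Whp p Q := by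
  refine whp_of_measureReal_le (whp_iff_tendsto_measureReal.1 hP) ?_
  filter_upwards [h] with n hn
  exact measureReal_mono fun Γ hΓ hP => hΓ (hn Γ hP)

lemma Whp.and (hP : Whp p P) (hQ : Whp p Q) : Whp p fun n Γ => P n Γ ∧ Q n Γ := by
  have := (whp_iff_tendsto_measureReal.1 hP).add (whp_iff_tendsto_measureReal.1 hQ)
  rw [add_zero] at this
  refine whp_of_measureReal_le this (.of_forall fun n => ?_)
  refine (measureReal_mono ?_).trans (measureReal_union_le _ _)
  intro Γ hΓ
  exact not_and_or.1 hΓ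

lemma Whp.exists (hP : Whp p P) : ∀ᶠ n in atTop, ∃ Γ, P n Γ := by
  have h : ∀ᶠ n in atTop, (binomialRandom (Fin n) (p n)).real {Γ | ¬ P n Γ} < 1 :=
    (whp_iff_tendsto_measureReal.1 hP).eventually_lt_const zero_lt_one
  filter_upwards [h] with n hn
  by_contra! hno
  have : {Γ | ¬ P n Γ} = Set.univ := Set.eq_univ_of_forall hno
  rw [this, probReal_univ] at hn
  exact lt_irrefl _ hn

lemma eventually_le_mul_sqrt
    (hp : (fun n : ℕ => (n : ℝ) ^ (-(1 / 2) : ℝ)) =o[atTop] (fun n => (p n : ℝ))) {K : ℝ}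
    (hK : 0 < K) : ∀ᶠ n : ℕ in atTop, K ≤ p n * √n := by
  filter_upwards [hp.def (inv_pos.2 hK), eventually_gt_atTop 0] with n hn hn0
  have hn0' : (0 : ℝ) < n := by exact_mod_cast hn0
  rw [Real.norm_of_nonneg (by positivity), Real.norm_of_nonneg (p n).2.1,
    Real.rpow_neg hn0'.le, ← Real.sqrt_eq_rpow] at hn
  have hs : 0 < √(n : ℝ) := Real.sqrt_pos.2 hn0'
  have := mul_le_mul_of_nonneg_right hn hs.le
  rw [inv_mul_cancel₀ hs.ne', mul_assoc] at this
  calc K = K * 1 := (mul_one K).symm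
    _ ≤ K * (K⁻¹ * (p n * √n)) := mul_le_mul_of_nonneg_left this hK.le
    _ = p n * √n := by field_simp

lemma eventually_prob_le
    (hp : (fun n : ℕ => (p n : ℝ)) =o[atTop] (fun _ => (1 : ℝ))) {ε : ℝ} (hε : 0 < ε) :
    ∀ᶠ n : ℕ in atTop, (p n : ℝ) ≤ ε := by
  filter_upwards [hp.def hε] with n hn
  rw [Real.norm_of_nonneg (p n).2.1] at hn
  simpa using hn

end Whp

/-! ### Existence of levels with high probability. -/

lemma half_mul_le_one_sub_pow {x : ℝ} (hx0 : 0 ≤ x) (hx1 : x ≤ 1) {L : ℕ} (h : x * L ≤ 1) :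
    x * L / 2 ≤ 1 - (1 - x) ^ L := by
  have h1 : (1 - x) ^ L ≤ Real.exp (-(x * L)) := by
    calc (1 - x) ^ L ≤ Real.exp (-x) ^ L :=
          pow_le_pow_left₀ (by linarith) (by have := Real.add_one_le_exp (-x); linarith) _
      _ = Real.exp (-(x * L)) := by rw [← Real.exp_nat_mul]; ring_nf
  set y := x * L
  have hy : 0 ≤ y := by positivity
  have h2 : Real.exp (-y) * (1 + y) ≤ 1 := by
    have := Real.add_one_le_exp y
    calc Real.exp (-y) * (1 + y) ≤ Real.exp (-y) * Real.exp y :=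
          mul_le_mul_of_nonneg_left (by linarith) (Real.exp_pos _).le
      _ = 1 := by rw [← Real.exp_add]; simp
  have h3 := Real.exp_pos (-y)
  nlinarith

lemma eventually_sqrt_mul_log_le {c : ℝ} (hc : 0 < c) :
    ∀ᶠ n : ℕ in atTop, √(n : ℝ) * Real.log n ≤ c * n := by
  have h1 := Real.isLittleO_log_id_atTop.def (half_pos hc)
  have h2 : Tendsto (fun n : ℕ => √(n : ℝ)) atTop atTop :=
    Real.tendsto_sqrt_atTop.comp tendsto_natCast_atTop_atTop
  filter_upwards [h2.eventually h1, eventually_ge_atTop 1] with n hn hn1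
  have hn1' : (1 : ℝ) ≤ n := by exact_mod_cast hn1
  simp only [id] at hn
  rw [Real.norm_of_nonneg (Real.sqrt_nonneg _)] at hn
  have h3 := (Real.le_norm_self _).trans hn
  rw [Real.log_sqrt (by linarith)] at h3
  have h4 := Real.sq_sqrt (show (0 : ℝ) ≤ n by linarith)
  have h5 := mul_le_mul_of_nonneg_left h3 (Real.sqrt_nonneg n)
  nlinarith

lemma eventually_sqrt_le {c : ℝ} (hc : 0 < c) : ∀ᶠ n : ℕ in atTop, √(n : ℝ) ≤ c * n := by
  have h2 : Tendsto (fun n : ℕ => √(n : ℝ)) atTop atTop :=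
    Real.tendsto_sqrt_atTop.comp tendsto_natCast_atTop_atTop
  filter_upwards [h2.eventually_ge_atTop c⁻¹] with n hn
  have h4 := Real.sq_sqrt (show (0 : ℝ) ≤ n by positivity)
  have h5 := mul_le_mul_of_nonneg_left hn hc.le
  rw [mul_inv_cancel₀ hc.ne'] at h5
  nlinarith [Real.sqrt_nonneg (n : ℝ)]

lemma tendsto_const_mul_exp_neg {C c : ℝ} (hc : 0 < c) :
    Tendsto (fun n : ℕ => C * Real.exp (-(c * n))) atTop (nhds 0) := by
  have : Tendsto (fun n : ℕ => c * (n : ℝ)) atTop atTop :=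
    tendsto_natCast_atTop_atTop.const_mul_atTop hc
  simpa using (Real.tendsto_exp_neg_atTop_nhds_zero.comp this).const_mul C

/-- With high probability the random graph contains a system of levels, indexed by a given finite
type, of total size at most `ε / p`, such that there are no holes between the levels. -/
lemma whp_exists_levels {F : Type*} [Fintype F] [Nonempty F] {p : ℕ → unitInterval}
    (hp_lower : (fun n : ℕ => (n : ℝ) ^ (-(1 / 2) : ℝ)) =o[atTop] (fun n => (p n : ℝ)))
    (hp_upper : (fun n : ℕ => (p n : ℝ)) =o[atTop] (fun _ => (1 : ℝ)))
    {k : ℕ} (hk : 0 < k) {ε : ℝ} (hε : 0 < ε) (hε1 : ε ≤ 1) :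
    Whp p fun n Γ => ∃ (D L : ℕ) (φ : F → Fin D × Fin L → Fin n), 0 < D ∧ 0 < L ∧
      (Fintype.card F * (D * L) : ℝ) * p n ≤ ε ∧
      (∀ i j a b, φ i a = φ j b → i = j ∧ a = b) ∧
      ∀ i j, i ≠ j → NoHole Γ k (φ i) (φ j) := by
  classical
  set T := Fintype.card F with hT
  have hT0 : 0 < T := Fintype.card_pos
  have hT0' : (0 : ℝ) < T := by exact_mod_cast hT0
  have hk' : (0 : ℝ) < k := by exact_mod_cast hk
  obtain ⟨D, hD0, hD⟩ : ∃ D : ℕ, 0 < D ∧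
      32 * (4 * T : ℝ) ^ k * Real.exp (-(D / k : ℝ)) ≤ 1 := by
    have h1 : Tendsto (fun D : ℕ => 32 * (4 * T : ℝ) ^ k * Real.exp (-((k : ℝ)⁻¹ * D))) atTop
        (nhds 0) := tendsto_const_mul_exp_neg (inv_pos.2 hk')
    obtain ⟨D, h2, h3⟩ := ((h1.eventually_le_const zero_lt_one).and (eventually_gt_atTop 0)).exists
    exact ⟨D, h3, by rwa [div_eq_inv_mul]⟩
  have hD0' : (0 : ℝ) < D := by exact_mod_cast hD0
  set ζ := Real.exp (-(D / k : ℝ)) with hζ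
  have hζ0 : 0 < ζ := Real.exp_pos _
  -- Since `p L` is at least `ε / (2TD)`, half of it bounds from below the probability of hitting a
  -- block.
  set c := ε / (4 * (T * D)) with hc
  have hc0 : 0 < c := by positivity
  set c₀ := c ^ (T * D) * ζ / 20 with hc₀
  have hc₀0 : 0 < c₀ := by positivity
  let L : ℕ → ℕ := fun n => ⌊ε / (T * D * p n)⌋₊
  have hLfacts : ∀ᶠ n in atTop, 0 < (p n : ℝ) ∧ (T * (D * L n) : ℝ) * p n ≤ ε ∧ 0 < L n ∧
      c ≤ 1 - (1 - (p n : ℝ)) ^ L n ∧ (T * (D * L n) : ℝ) ≤ √n := by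
    filter_upwards [eventually_le_mul_sqrt hp_lower one_pos,
      eventually_prob_le hp_upper (show 0 < ε / (2 * (T * D)) by positivity)] with n h1 h2
    have hp0 : 0 < (p n : ℝ) := by
      rcases (p n).2.1.lt_or_eq with h | h
      · exact h
      · rw [← h] at h1; norm_num at h1
    have hfl : (L n : ℝ) ≤ ε / (T * D * p n) := Nat.floor_le (by positivity)
    have hfl' : ε / (T * D * p n) < L n + 1 := Nat.lt_floor_add_one _
    rw [le_div_iff₀ (by positivity)] at hfl
    rw [div_lt_iff₀ (by positivity)] at hfl'
    rw [le_div_iff₀ (by positivity)] at h2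
    have hlow : ε / 2 ≤ L n * (T * D * p n) := by linarith
    have hL0 : 0 < L n := by
      rcases Nat.eq_zero_or_pos (L n) with h | h
      · rw [h] at hlow; norm_num at hlow; linarith
      · exact h
    have hTD1 : (1 : ℝ) ≤ T * D := by exact_mod_cast Nat.mul_pos hT0 hD0
    have hpL0 : 0 ≤ (p n : ℝ) * L n := by positivity
    refine ⟨hp0, by linarith, hL0, ?_, ?_⟩
    · refine le_trans ?_ (half_mul_le_one_sub_pow hp0.le (p n).2.2 ?_)
      · rw [hc, div_le_iff₀ (by positivity)]
        linarith
      · nlinarith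
    · have h3 : (T * (D * L n) : ℝ) * p n ≤ √n * p n := by linarith
      exact le_of_mul_le_mul_right h3 hp0
  refine whp_of_measureReal_le (f := fun n : ℕ => 2 ^ T * (2 * T) * Real.exp (-(c₀ / 2 * n)))
    (tendsto_const_mul_exp_neg (half_pos hc₀0)) ?_
  filter_upwards [hLfacts, eventually_sqrt_mul_log_le (show 0 < c₀ / 4 by positivity),
    eventually_sqrt_le (show 0 < c₀ / 4 by positivity),
    eventually_sqrt_le (show (0 : ℝ) < 1 / 2 by positivity),
    eventually_sqrt_le (show 0 < c ^ (T * D) / 8 by positivity), eventually_gt_atTop 0]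
    with n ⟨hp0, hLp, hL0, hcp, hLs⟩ hs1 hs2 hs3 hs4 hn0
  have hn0' : (0 : ℝ) < n := by exact_mod_cast hn0
  have hDL : (D * L n : ℝ) ≤ T * (D * L n) :=
    le_mul_of_one_le_left (by positivity) (by exact_mod_cast hT0)
  have hn1 : 2 * (T * (D * L n)) ≤ n := by
    have : (2 * (T * (D * L n)) : ℝ) ≤ n := by linarith
    exact_mod_cast this
  have hn2 : 8 * (D * L n : ℝ) ≤ n * c ^ (T * D) := by linarith
  have hsub : {Γ : SimpleGraph (Fin n) | ¬ ∃ (D L : ℕ) (φ : F → Fin D × Fin L → Fin n),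
      0 < D ∧ 0 < L ∧ (T * (D * L) : ℝ) * p n ≤ ε ∧
      (∀ i j a b, φ i a = φ j b → i = j ∧ a = b) ∧ ∀ i j, i ≠ j → NoHole Γ k (φ i) (φ j)} ⊆
      ⋃ x : Finset F × (F → Fin D × Fin (L n) → Fin n), {Γ | (x.1.Nonempty ∧
        ∀ i ∈ x.1, ∀ j ∈ x.1, ∀ a b, x.2 i a = x.2 j b → i = j ∧ a = b) ∧
          ¬ CanExtend Γ k x.1 x.2} := by
    intro Γ hΓ
    by_contra hno
    have hle : D * L n ≤ n := by
      have := Nat.le_mul_of_pos_left (D * L n) hT0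
      omega
    obtain ⟨φ, h1, h2⟩ := exists_levels_of_canExtend (F := F) hle (fun J hJ φ hφ =>
      by_contra fun h => hno (Set.mem_iUnion.2 ⟨(J, φ), ⟨hJ, hφ⟩, h⟩)) Finset.univ
    exact hΓ ⟨D, L n, φ, hD0, hL0, hLp, fun i j => h1 i (Finset.mem_univ _) j (Finset.mem_univ _),
      fun i j => h2 i (Finset.mem_univ _) j (Finset.mem_univ _)⟩
  -- Union bound over at most `2^T * n^(TDL)` placements. As `TDL ≤ √n`, their number is
  -- `exp(o(n))`, against a failure probability exponentially small in `n`.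
  refine (measureReal_mono hsub).trans ((measureReal_iUnion_fintype_le _).trans ?_)
  have hterm : ∀ x : Finset F × (F → Fin D × Fin (L n) → Fin n),
      (binomialRandom (Fin n) (p n)).real {Γ | (x.1.Nonempty ∧
        ∀ i ∈ x.1, ∀ j ∈ x.1, ∀ a b, x.2 i a = x.2 j b → i = j ∧ a = b) ∧
          ¬ CanExtend Γ k x.1 x.2} ≤
        (1 + T * 2 ^ (D * L n)) * Real.exp (-(c₀ * n)) := by
    rintro ⟨J, φ⟩
    by_cases h : J.Nonempty ∧ ∀ i ∈ J, ∀ j ∈ J, ∀ a b, φ i a = φ j b → i = j ∧ a = b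
    · refine (measureReal_mono fun Γ hΓ => hΓ.2).trans ?_
      refine (measureReal_not_canExtend_le h.1 h.2 hD0 hL0 hk hc0 hcp hD hn1 hn2).trans
        (le_of_eq ?_)
      rw [hc₀, ← hT, ← hζ]
      congr 3
      ring
    · simp only [h, false_and, Set.ofPred_false, measureReal_empty]
      positivity
  refine (Finset.sum_le_card_nsmul _ _ _ fun x _ => hterm x).trans ?_
  rw [Finset.card_univ, Fintype.card_prod, Fintype.card_finset, Fintype.card_fun, Fintype.card_fun,
    Fintype.card_prod, Fintype.card_fin, Fintype.card_fin, Fintype.card_fin, nsmul_eq_mul, ← hT,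
    ← pow_mul]
  push_cast
  have hlog0 : 0 ≤ Real.log n := Real.log_natCast_nonneg n
  have e1 : (n : ℝ) ^ (D * L n * T) ≤ Real.exp (c₀ / 4 * n) := by
    rw [← Real.exp_log hn0', ← Real.exp_nat_mul, Real.exp_log hn0']
    refine Real.exp_le_exp.2 (le_trans ?_ hs1)
    refine mul_le_mul_of_nonneg_right ?_ hlog0
    push_cast; linarith
  have e2 : (1 + T * 2 ^ (D * L n) : ℝ) ≤ 2 * T * Real.exp (c₀ / 4 * n) := by
    have h2 : (2 : ℝ) ^ (D * L n) ≤ Real.exp (c₀ / 4 * n) := by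
      calc (2 : ℝ) ^ (D * L n) ≤ Real.exp 1 ^ (D * L n) :=
            pow_le_pow_left₀ (by norm_num) (by have := Real.add_one_le_exp 1; linarith) _
        _ = Real.exp (D * L n) := by rw [← Real.exp_nat_mul]; push_cast; ring_nf
        _ ≤ _ := Real.exp_le_exp.2 (by linarith)
    have h3 : (1 : ℝ) ≤ T := by exact_mod_cast hT0
    have h4 : (1 : ℝ) ≤ Real.exp (c₀ / 4 * n) := Real.one_le_exp (by positivity)
    nlinarith
  calc (2 : ℝ) ^ T * (n : ℝ) ^ (D * L n * T) * ((1 + T * 2 ^ (D * L n)) * Real.exp (-(c₀ * n)))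
      ≤ 2 ^ T * Real.exp (c₀ / 4 * n) *
        (2 * T * Real.exp (c₀ / 4 * n) * Real.exp (-(c₀ * n))) := by gcongr
    _ = 2 ^ T * (2 * T) * (Real.exp (c₀ / 4 * n) * Real.exp (c₀ / 4 * n) *
        Real.exp (-(c₀ * n))) := by ring
    _ = 2 ^ T * (2 * T) * Real.exp (-(c₀ / 2 * n)) := by
        rw [← Real.exp_add, ← Real.exp_add]; congr 2; ring

/-! ### Degrees in the random graph. -/

section

open Classical in
/-- The number of neighbours of `v` in `S`. -/
noncomputable def degIn {V : Type*} (Γ : SimpleGraph V) (v : V) (S : Finset V) : ℕ :=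
  {u ∈ S | Γ.Adj v u}.card

lemma degIn_mono {V : Type*} (Γ : SimpleGraph V) (v : V) {S S' : Finset V} (h : S ⊆ S') :
    degIn Γ v S ≤ degIn Γ v S' := by
  classical
  exact Finset.card_le_card (Finset.filter_subset_filter _ h)

lemma degIn_le_card {V : Type*} (Γ : SimpleGraph V) (v : V) (S : Finset V) :
    degIn Γ v S ≤ S.card := by
  classical
  exact Finset.card_filter_le _ _

lemma degIn_le_sdiff_add {V : Type*} [DecidableEq V] (Γ : SimpleGraph V) (v : V)
    (S S' : Finset V) : degIn Γ v S ≤ degIn Γ v (S \ S') + degIn Γ v S' := by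
  classical
  unfold degIn
  refine le_trans (Finset.card_le_card fun u hu => ?_) (Finset.card_union_le _ _)
  simp only [Finset.mem_filter, Finset.mem_union, Finset.mem_sdiff] at hu ⊢
  tauto

lemma card_filter_image_star {V : Type*} [DecidableEq V] (Γ : SimpleGraph V)
    [DecidablePred (· ∈ Γ.edgeSet)] (v : V) (S : Finset V) :
    {e ∈ S.image fun u => s(v, u) | e ∈ Γ.edgeSet}.card = degIn Γ v S := by
  unfold degIn
  rw [Finset.filter_image, Finset.card_image_of_injective]
  · congr!
  · intro a b h
    exact Sym2.congr_right.1 h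

section Tails

variable {n : ℕ} {p : unitInterval}

lemma measureReal_le_degIn (v : Fin n) {S : Finset (Fin n)} (hv : v ∉ S) (a : ℝ) :
    (binomialRandom (Fin n) p).real {Γ | a ≤ degIn Γ v S} ≤ Real.exp (2 * p * S.card - a) := by
  classical
  have h := measureReal_le_card_filter_mem_edgeSet (p := p) (Q := S.image fun u => s(v, u))
    (by simpa using hv) a
  rw [Finset.card_image_of_injective _ fun a b h => Sym2.congr_right.1 h] at h
  simpa only [card_filter_image_star] using h

/-- Uses `exp(-t) ≤ 1/(1+t) ≤ 1 - t + t^2`. The loss against the mean is of second order in `t`, so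
a small `t` detects any fixed relative deviation. -/
lemma measureReal_degIn_le (v : Fin n) {S : Finset (Fin n)} (hv : v ∉ S) (a : ℝ) {t : ℝ}
    (ht : 0 ≤ t) : (binomialRandom (Fin n) p).real {Γ | (degIn Γ v S : ℝ) ≤ a} ≤
      Real.exp (t * a - (t - t ^ 2) * (p * S.card)) := by
  classical
  have h := measureReal_card_filter_mem_edgeSet_le (p := p) (Q := S.image fun u => s(v, u))
    (by simpa using hv) a ht
  rw [Finset.card_image_of_injective _ fun a b h => Sym2.congr_right.1 h] at h
  simp only [card_filter_image_star] at h
  refine h.trans (Real.exp_le_exp.2 ?_)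
  have h1 : Real.exp (-t) * (1 + t) ≤ 1 := by
    have := Real.add_one_le_exp t
    calc Real.exp (-t) * (1 + t) ≤ Real.exp (-t) * Real.exp t :=
          mul_le_mul_of_nonneg_left (by linarith) (Real.exp_pos _).le
      _ = 1 := by rw [← Real.exp_add]; simp
  have h2 : Real.exp (-t) ≤ 1 - t + t ^ 2 := by
    have h3 : (1 - t + t ^ 2) * (1 + t) = 1 + t ^ 3 := by ring
    have h4 : 0 ≤ t ^ 3 := by positivity
    exact le_of_mul_le_mul_right (h1.trans (by linarith)) (by linarith : 0 < 1 + t)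
  have h3 : (t - t ^ 2) * (p * S.card) ≤ (1 - Real.exp (-t)) * (p * S.card) :=
    mul_le_mul_of_nonneg_right (by linarith)
      (mul_nonneg p.2.1 (Nat.cast_nonneg _))
  linarith

end Tails

variable {p : ℕ → unitInterval}

lemma eventually_sqrt_le_prob_mul
    (hp : (fun n : ℕ => (n : ℝ) ^ (-(1 / 2) : ℝ)) =o[atTop] (fun n => (p n : ℝ))) :
    ∀ᶠ n : ℕ in atTop, √(n : ℝ) ≤ p n * n := by
  filter_upwards [eventually_le_mul_sqrt hp one_pos] with n hn
  have h1 := Real.mul_self_sqrt (show (0 : ℝ) ≤ n by positivity)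
  calc √(n : ℝ) = 1 * √n := (one_mul _).symm
    _ ≤ p n * √n * √n := mul_le_mul_of_nonneg_right hn (Real.sqrt_nonneg _)
    _ = p n * n := by rw [mul_assoc, h1]

lemma tendsto_mul_exp_neg_sqrt {C c : ℝ} (hc : 0 < c) :
    Tendsto (fun n : ℕ => C * (n * Real.exp (-(c * √n)))) atTop (nhds 0) := by
  have h2 : Tendsto (fun n : ℕ => √(n : ℝ)) atTop atTop :=
    Real.tendsto_sqrt_atTop.comp tendsto_natCast_atTop_atTop
  have h3 := ((Real.tendsto_pow_mul_exp_neg_atTop_nhds_zero 2).comp (h2.const_mul_atTop hc))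
  have h4 := h3.const_mul (C / c ^ 2)
  rw [mul_zero] at h4
  refine h4.congr fun n => ?_
  simp only [Function.comp_apply]
  rw [mul_pow, Real.sq_sqrt (by positivity)]
  field_simp

lemma card_filter_mod_eq_le (n R j : ℕ) :
    ((Finset.univ : Finset (Fin n)).filter fun u : Fin n => (u : ℕ) % R = j).card ≤ n / R + 1 := by
  have : ((Finset.univ : Finset (Fin n)).filter fun u : Fin n => (u : ℕ) % R = j).card ≤
      (Finset.range (n / R + 1)).card := by
    refine Finset.card_le_card_of_injOn (fun u => (u : ℕ) / R) ?_ ?_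
    · intro u _
      simp only [Finset.coe_range, Set.mem_Iio]
      exact Nat.lt_succ_of_le (Nat.div_le_div_right u.2.le)
    · intro u hu w hw h
      simp only [Finset.coe_filter, Finset.mem_univ, true_and, Set.mem_ofPred_eq] at hu hw
      refine Fin.ext ?_
      rw [← Nat.div_add_mod (u : ℕ) R, ← Nat.div_add_mod (w : ℕ) R, hu, hw]
      simp only at h
      rw [h]
  simpa using this

/-- With high probability every vertex has about the expected number of neighbours outside each
residue class modulo `R`. -/
lemma whp_le_degIn
    (hp : (fun n : ℕ => (n : ℝ) ^ (-(1 / 2) : ℝ)) =o[atTop] (fun n => (p n : ℝ)))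
    {R : ℕ} (hR : 0 < R) {γ : ℝ} (hγ : 0 < γ) :
    Whp p fun n Γ => ∀ (v : Fin n) (j : Fin R), (((R : ℝ) - 1) / R - γ) * (p n * n) ≤
      degIn Γ v (Finset.univ.filter fun u : Fin n => (u : ℕ) % R ≠ j) := by
  classical
  refine whp_of_measureReal_le (f := fun n : ℕ => (R : ℝ) * (n * Real.exp (-(γ ^ 2 / 16 * √n))))
    (tendsto_mul_exp_neg_sqrt (by positivity)) ?_
  have hR' : (0 : ℝ) < R := by exact_mod_cast hR
  filter_upwards [eventually_sqrt_le_prob_mul hp,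
    tendsto_natCast_atTop_atTop.eventually_ge_atTop (4 / γ)] with n hn hn4
  rw [div_le_iff₀ hγ] at hn4
  have hsub : {Γ : SimpleGraph (Fin n) | ¬ ∀ (v : Fin n) (j : Fin R),
      (((R : ℝ) - 1) / R - γ) * (p n * n) ≤
        degIn Γ v (Finset.univ.filter fun u : Fin n => (u : ℕ) % R ≠ j)} ⊆
      ⋃ x : Fin n × Fin R, {Γ | (degIn Γ x.1 ((Finset.univ.filter fun u : Fin n =>
        (u : ℕ) % R ≠ x.2).erase x.1) : ℝ) ≤ (((R : ℝ) - 1) / R - γ) * (p n * n)} := by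
    intro Γ hΓ
    simp only [Set.mem_ofPred_eq, not_forall, not_le] at hΓ
    obtain ⟨v, j, h⟩ := hΓ
    refine Set.mem_iUnion.2 ⟨(v, j), le_trans ?_ h.le⟩
    exact_mod_cast degIn_mono Γ v (Finset.erase_subset _ _)
  refine (measureReal_mono hsub).trans ((measureReal_iUnion_fintype_le _).trans ?_)
  refine (Finset.sum_le_card_nsmul _ _ (Real.exp (-(γ ^ 2 / 16 * √n))) ?_).trans ?_
  · rintro ⟨v, j⟩ _
    refine (measureReal_degIn_le v (Finset.notMem_erase _ _) _
      (show 0 ≤ γ / 4 by positivity)).trans (Real.exp_le_exp.2 ?_)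
    set S := (Finset.univ.filter fun u : Fin n => (u : ℕ) % R ≠ j).erase v
    -- One vertex is lost to rounding in the residue class, another to erasing `v`.
    have hS : (n : ℝ) * ((R - 1) / R) - 2 ≤ S.card := by
      have h1 : (Finset.univ.filter fun u : Fin n => (u : ℕ) % R ≠ j).card ≤ S.card + 1 :=
        Nat.sub_le_iff_le_add.1 Finset.pred_card_le_card_erase
      have h2 := Finset.card_filter_add_card_filter_not (s := (Finset.univ : Finset (Fin n)))
        (fun u : Fin n => (u : ℕ) % R = j)
      rw [Finset.card_univ, Fintype.card_fin] at h2
      have h3 := card_filter_mod_eq_le n R j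
      have h4 : n ≤ n / R + 2 + S.card := by
        simp only [ne_eq] at h1
        omega
      have h5 : (n : ℝ) ≤ (n / R : ℕ) + 2 + S.card := by exact_mod_cast h4
      have h6 : ((n / R : ℕ) : ℝ) ≤ n / R := Nat.cast_div_le
      have h7 : (n : ℝ) * ((R - 1) / R) = n - n / R := by field_simp
      linarith
    have hSn : (S.card : ℝ) ≤ n := by
      have := Finset.card_le_univ S
      rw [Fintype.card_fin] at this
      exact_mod_cast this
    have hp0 : 0 ≤ (p n : ℝ) := (p n).2.1
    have h1 := mul_le_mul_of_nonneg_left hS hp0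
    have h2 := mul_le_mul_of_nonneg_left hSn hp0
    have h3 := mul_le_mul_of_nonneg_left hn4 hp0
    have h4 : (((R : ℝ) - 1) / R - γ) * (p n * n) - p n * S.card ≤ -(γ * (p n * n) / 2) := by
      linarith
    have h5 := mul_le_mul_of_nonneg_left h4 (show 0 ≤ γ / 4 by positivity)
    have h6 := mul_le_mul_of_nonneg_left h2 (show 0 ≤ (γ / 4) ^ 2 by positivity)
    have h7 := mul_le_mul_of_nonneg_left hn (show 0 ≤ γ ^ 2 / 16 by positivity)
    linarith
  · rw [Finset.card_univ, Fintype.card_prod, Fintype.card_fin, Fintype.card_fin, nsmul_eq_mul]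
    push_cast
    apply le_of_eq
    ring

lemma whp_degIn_univ_le
    (hp : (fun n : ℕ => (n : ℝ) ^ (-(1 / 2) : ℝ)) =o[atTop] (fun n => (p n : ℝ))) :
    Whp p fun n Γ => ∀ v : Fin n, (degIn Γ v Finset.univ : ℝ) ≤ 4 * (p n * n) := by
  classical
  refine whp_of_measureReal_le (f := fun n : ℕ => (1 : ℝ) * (n * Real.exp (-(2 * √n))))
    (tendsto_mul_exp_neg_sqrt (by positivity)) ?_
  filter_upwards [eventually_sqrt_le_prob_mul hp] with n hn
  have hsub : {Γ : SimpleGraph (Fin n) | ¬ ∀ v : Fin n,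
      (degIn Γ v Finset.univ : ℝ) ≤ 4 * (p n * n)} ⊆
      ⋃ v : Fin n, {Γ | 4 * ((p n : ℝ) * n) ≤ (degIn Γ v (Finset.univ.erase v) : ℝ)} := by
    intro Γ hΓ
    simp only [Set.mem_ofPred_eq, not_forall, not_le] at hΓ
    obtain ⟨v, h⟩ := hΓ
    refine Set.mem_iUnion.2 ⟨v, h.le.trans (le_of_eq ?_)⟩
    unfold degIn
    congr 2
    ext u
    simp only [Finset.mem_filter, Finset.mem_univ, true_and, Finset.mem_erase, and_true]
    exact ⟨fun h => ⟨h.ne', h⟩, fun h => h.2⟩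
  refine (measureReal_mono hsub).trans ((measureReal_iUnion_fintype_le _).trans ?_)
  refine (Finset.sum_le_card_nsmul _ _ (Real.exp (-(2 * √n))) ?_).trans ?_
  · rintro v _
    refine (measureReal_le_degIn v (Finset.notMem_erase _ _) _).trans (Real.exp_le_exp.2 ?_)
    have hSn : ((Finset.univ.erase v).card : ℝ) ≤ n := by
      have := Finset.card_le_univ (Finset.univ.erase v)
      rw [Fintype.card_fin] at this
      exact_mod_cast this
    have h2 := mul_le_mul_of_nonneg_left hSn (p n).2.1
    linarith
  · rw [Finset.card_univ, Fintype.card_fin, nsmul_eq_mul, one_mul]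

open Classical in
/-- With high probability, no small set `N` of vertices receives many edges from many vertices. -/
lemma whp_card_le_of_degIn
    (hp : (fun n : ℕ => (n : ℝ) ^ (-(1 / 2) : ℝ)) =o[atTop] (fun n => (p n : ℝ)))
    {γ β η : ℝ} (hβ : 0 < β) (hβγ : β ≤ γ / 4) (hη : η ≤ γ / 8) :
    Whp p fun n Γ => ∀ N : Finset (Fin n), (N.card : ℝ) ≤ η * n →
      ((Finset.univ.filter fun v => γ * (p n * n) ≤ degIn Γ v N).card : ℝ) ≤ β * (p n * n) := by
  have hγ : 0 < γ := by linarith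
  refine whp_of_measureReal_le (f := fun n : ℕ => (1 : ℝ) * Real.exp (-(1 * n)))
    (tendsto_const_mul_exp_neg one_pos) ?_
  filter_upwards [eventually_sqrt_le_prob_mul hp,
    eventually_le_mul_sqrt hp (show 0 < √(12 / (β * γ)) by positivity),
    (Real.tendsto_sqrt_atTop.comp tendsto_natCast_atTop_atTop).eventually_ge_atTop (1 / β)]
    with n hn hK hβn
  simp only [Function.comp_apply] at hβn
  have hp0 : 0 ≤ (p n : ℝ) := (p n).2.1
  set x : ℝ := p n * n with hx
  have hx0 : 0 ≤ x := by positivity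
  have hβx : 1 ≤ β * x := by
    have := hβn.trans hn
    rwa [div_le_iff₀ hβ, mul_comm] at this
  -- This is where `p ≫ n^(-1/2)` enters: `b` vertices of degree about `x` into `N` involve order
  -- `x^2` edges, which must outweigh the `4^n` choices of `N` and `B`.
  have hxsq : 12 * n ≤ β * γ * x ^ 2 := by
    have h1 := pow_le_pow_left₀ (Real.sqrt_nonneg _) hK 2
    rw [Real.sq_sqrt (by positivity), div_le_iff₀ (by positivity), mul_pow,
      Real.sq_sqrt (by positivity)] at h1
    have h2 := mul_le_mul_of_nonneg_right h1 (show (0 : ℝ) ≤ n by positivity)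
    rw [hx]
    linarith
  set b := ⌈β * x⌉₊ with hb
  have hb1 : β * x ≤ b := Nat.le_ceil _
  have hb2 : (b : ℝ) ≤ 2 * (β * x) := by
    have := Nat.ceil_lt_add_one (show 0 ≤ β * x by positivity)
    linarith
  have hsub : {Γ : SimpleGraph (Fin n) | ¬ ∀ N : Finset (Fin n), (N.card : ℝ) ≤ η * n →
      ((Finset.univ.filter fun v => γ * x ≤ degIn Γ v N).card : ℝ) ≤ β * x} ⊆
      ⋃ y : Finset (Fin n) × Finset (Fin n), {Γ | ((y.1.card : ℝ) ≤ η * n ∧ y.2.card = b) ∧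
        ∀ v ∈ y.2, γ * x ≤ degIn Γ v y.1} := by
    intro Γ hΓ
    simp only [Set.mem_ofPred_eq, not_forall, not_le] at hΓ
    obtain ⟨N, hN, h⟩ := hΓ
    have hle : b ≤ (Finset.univ.filter fun v => γ * x ≤ degIn Γ v N).card := Nat.ceil_le.2 h.le
    obtain ⟨B, hB, hBb⟩ := Finset.exists_subset_card_eq hle
    exact Set.mem_iUnion.2 ⟨(N, B), ⟨hN, hBb⟩, fun v hv => (Finset.mem_filter.1 (hB hv)).2⟩
  refine (measureReal_mono hsub).trans ((measureReal_iUnion_fintype_le _).trans ?_)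
  refine (Finset.sum_le_card_nsmul _ _ (Real.exp (-(3 * n))) ?_).trans ?_
  · rintro ⟨N, B⟩ _
    by_cases h : (N.card : ℝ) ≤ η * n ∧ B.card = b
    swap
    · simp only [h, false_and, Set.ofPred_false, measureReal_empty]
      positivity
    -- Removing `B` from `N` prevents an edge from being counted at both ends. It costs each vertex
    -- at most `b ≤ γ x / 2` neighbours.
    set Q := (B ×ˢ (N \ B)).image fun y => s(y.1, y.2) with hQ
    have hQdiag : ∀ e ∈ Q, ¬ e.IsDiag := by
      intro e he
      simp only [hQ, Finset.mem_image, Finset.mem_product, Finset.mem_sdiff, Prod.exists] at he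
      obtain ⟨v, u, ⟨hv, _, hu⟩, rfl⟩ := he
      rw [Sym2.mk_isDiag_iff]
      exact fun h => hu (h ▸ hv)
    have hQcard : (Q.card : ℝ) ≤ b * (η * n) := by
      have h1 : Q.card ≤ B.card * N.card := Finset.card_image_le.trans (by
        rw [Finset.card_product]
        exact Nat.mul_le_mul_left _ (Finset.card_le_card Finset.sdiff_subset))
      rw [h.2] at h1
      calc (Q.card : ℝ) ≤ b * N.card := by exact_mod_cast h1
        _ ≤ _ := mul_le_mul_of_nonneg_left h.1 (by positivity)
    have hincl : {Γ : SimpleGraph (Fin n) | ((N.card : ℝ) ≤ η * n ∧ B.card = b) ∧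
        ∀ v ∈ B, γ * x ≤ degIn Γ v N} ⊆
        {Γ | b * (γ * x / 2) ≤ ({e ∈ Q | e ∈ Γ.edgeSet}.card : ℝ)} := by
      rintro Γ ⟨_, hΓ⟩
      have h1 : ∀ v ∈ B, γ * x / 2 ≤ (degIn Γ v (N \ B) : ℝ) := by
        intro v hv
        have h2 : (degIn Γ v N : ℝ) ≤ degIn Γ v (N \ B) + degIn Γ v B := by
          exact_mod_cast degIn_le_sdiff_add Γ v N B
        have h3 : (degIn Γ v B : ℝ) ≤ b := by
          rw [← h.2]
          exact_mod_cast degIn_le_card Γ v B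
        have h4 := hΓ v hv
        have h5 := mul_le_mul_of_nonneg_right hβγ hx0
        linarith
      have h2 : ∑ v ∈ B, degIn Γ v (N \ B) ≤ {e ∈ Q | e ∈ Γ.edgeSet}.card := by
        unfold degIn
        rw [← Finset.card_sigma]
        refine Finset.card_le_card_of_injOn (fun y => s(y.1, y.2)) ?_ ?_
        · rintro ⟨v, u⟩ hy
          simp only [Finset.coe_sigma, Set.mem_sigma_iff, Finset.mem_coe, Finset.mem_filter] at hy
          simp only [Finset.coe_filter, Set.mem_ofPred_eq]
          exact ⟨Finset.mem_image.2 ⟨(v, u), Finset.mem_product.2 ⟨hy.1, hy.2.1⟩, rfl⟩, hy.2.2⟩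
        · rintro ⟨v, u⟩ hy ⟨v', u'⟩ hy' heq
          simp only [Finset.coe_sigma, Set.mem_sigma_iff, Finset.mem_coe, Finset.mem_filter,
            Finset.mem_sdiff] at hy hy'
          simp only [Sym2.eq_iff] at heq
          rcases heq with ⟨rfl, rfl⟩ | ⟨rfl, rfl⟩
          · rfl
          · exact absurd hy.1 hy'.2.1.2
      have h3 : b * (γ * x / 2) ≤ ∑ v ∈ B, (degIn Γ v (N \ B) : ℝ) := by
        rw [← h.2, ← nsmul_eq_mul]
        exact Finset.card_nsmul_le_sum _ _ _ h1
      refine h3.trans ?_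
      exact_mod_cast h2
    refine (measureReal_mono hincl).trans
      ((measureReal_le_card_filter_mem_edgeSet hQdiag _).trans (Real.exp_le_exp.2 ?_))
    have h1 := mul_le_mul_of_nonneg_left hQcard (show 0 ≤ 2 * (p n : ℝ) by positivity)
    have hbx : 0 ≤ (b : ℝ) * x := by positivity
    have h2 := mul_le_mul_of_nonneg_right hη hbx
    have h3 := mul_le_mul_of_nonneg_left hb1 (show 0 ≤ γ * x / 4 by positivity)
    have h4 : 2 * (p n : ℝ) * (b * (η * n)) = 2 * (η * (b * x)) := by rw [hx]; ring
    linarith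
  · rw [Finset.card_univ, Fintype.card_prod, Fintype.card_finset, Fintype.card_fin, nsmul_eq_mul,
      one_mul, one_mul]
    push_cast
    have h1 : (2 : ℝ) ^ n ≤ Real.exp n := by
      calc (2 : ℝ) ^ n ≤ Real.exp 1 ^ n :=
            pow_le_pow_left₀ (by norm_num) (by have := Real.add_one_le_exp 1; linarith) _
        _ = Real.exp n := by rw [← Real.exp_nat_mul, mul_one]
    calc (2 : ℝ) ^ n * 2 ^ n * Real.exp (-(3 * n)) ≤
          Real.exp n * Real.exp n * Real.exp (-(3 * n)) := by gcongr
      _ = Real.exp (-n) := by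
          rw [← Real.exp_add, ← Real.exp_add]; congr 1; ring

end

/-! ### The planted graph: local colourability and chromatic number. -/

section Construction

variable {V W K : Type*}

/-- The subgraph of `Γ` made up of the edges inside `X` that follow `F` along `lev`, the edges
between `X` and the vertices outside `X ∪ B`, and the edges outside `X` that are properly coloured
by `c`. -/
def levelGraph (Γ : SimpleGraph V) (F : SimpleGraph W) (lev : V → W) (X B : Set V) (c : V → K) :
    SimpleGraph V where
  Adj u v := Γ.Adj u v ∧ ((u ∈ X ∧ v ∈ X ∧ F.Adj (lev u) (lev v)) ∨ (u ∈ X ∧ v ∉ X ∧ v ∉ B) ∨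
    (v ∈ X ∧ u ∉ X ∧ u ∉ B) ∨ (u ∉ X ∧ v ∉ X ∧ c u ≠ c v))
  symm := ⟨fun u v h => ⟨h.1.symm, by
    rcases h.2 with ⟨h1, h2, h3⟩ | h | h | ⟨h1, h2, h3⟩
    · exact Or.inl ⟨h2, h1, h3.symm⟩
    · exact Or.inr (Or.inr (Or.inl h))
    · exact Or.inr (Or.inl h)
    · exact Or.inr (Or.inr (Or.inr ⟨h2, h1, h3.symm⟩))⟩⟩
  loopless := ⟨fun u h => Γ.loopless.irrefl u h.1⟩

variable {Γ : SimpleGraph V} {F : SimpleGraph W} {lev : V → W} {X B : Set V} {c : V → K}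

lemma levelGraph_le : levelGraph Γ F lev X B c ≤ Γ := fun _ _ h => h.1

/-- The part of `S` in `X` maps to the shift graph, hence is bipartite and gets colours `1` and `2`.
Its neighbours outside `X` have colour `0` by `hc`, and outside `X` the colouring `c` is proper by
construction. -/
lemma coe_colorable_of_levelGraph {s N R : ℕ} (hR : 3 ≤ R) {lev : V → Fin (2 * s + 1) → Fin N}
    {c : V → Fin R}
    (hc : ∀ x ∈ X, ∀ v, v ∉ X → v ∉ B → Γ.Adj x v → c v = ⟨0, by omega⟩)
    (S : (levelGraph Γ (shiftGraph (2 * s + 1) N) lev X B c).Subgraph) (hfin : S.verts.Finite)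
    (hS : S.verts.ncard = s) : S.coe.Colorable R := by
  classical
  have : Finite S.verts := hfin
  let H : SimpleGraph {v : S.verts // (v : V) ∈ X} := S.coe.comap Subtype.val
  have hcard : Nat.card {v : S.verts // (v : V) ∈ X} ≤ s := by
    have h := Nat.card_le_card_of_injective (Subtype.val : {v : S.verts // (v : V) ∈ X} → S.verts)
      Subtype.val_injective
    rw [Nat.card_coe_set_eq] at h
    exact h.trans hS.le
  obtain ⟨C⟩ : H.Colorable 2 := colorable_two_of_hom_shiftGraph hcard (fun v => lev v.1)
    (by
      intro a b hab
      have hab' := (S.adj_sub hab).2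
      have ha := a.2
      have hb := b.2
      rcases hab' with h | h | h | h
      · exact h.2.2
      · exact absurd hb h.2.1
      · exact absurd ha h.2.1
      · exact absurd ha h.1)
  have hC : ∀ v, (C v : ℕ) + 1 < R := fun v => by have := (C v).2; omega
  refine ⟨Coloring.mk (fun v => if h : (v : V) ∈ X then (⟨C ⟨v, h⟩ + 1, hC _⟩ : Fin R) else c v) ?_⟩
  intro u v huv heq
  have huv' := S.adj_sub huv
  by_cases hu : (u : V) ∈ X <;> by_cases hv : (v : V) ∈ X
  · rw [dif_pos hu, dif_pos hv] at heq
    simp only [Fin.mk.injEq, Nat.add_right_cancel_iff] at heq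
    exact C.valid (show H.Adj ⟨u, hu⟩ ⟨v, hv⟩ from huv) (Fin.ext heq)
  · rw [dif_pos hu, dif_neg hv] at heq
    rcases huv'.2 with h | h | h | h
    · exact hv h.2.1
    · rw [hc u hu v hv h.2.2 huv'.1] at heq
      simp at heq
    · exact hv h.1
    · exact h.1 hu
  · rw [dif_neg hu, dif_pos hv] at heq
    rcases huv'.2 with h | h | h | h
    · exact hu h.1
    · exact hu h.1
    · rw [hc v hv u hu h.2.2 huv'.1.symm] at heq
      simp at heq
    · exact h.2.1 hv
  · rw [dif_neg hu, dif_neg hv] at heq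
    rcases huv'.2 with h | h | h | h
    · exact hu h.1
    · exact hu h.1
    · exact hv h.1
    · exact h.2.2 heq

/-- Some colour fills a `1/k`-proportion of each level. Adjacent levels cannot share it, since an
edge would join the two colour classes; this would colour `F`. -/
lemma not_colorable_levelGraph {I : Type*} [Fintype I] {k : ℕ} (hk : 0 < k)
    (hF : ¬ F.Colorable k) {φ : W → I → V} (hX : ∀ w a, φ w a ∈ X) (hlev : ∀ w a, lev (φ w a) = w)
    (hole : ∀ w w', w ≠ w' → NoHole Γ k (φ w) (φ w')) :
    ¬ (levelGraph Γ F lev X B c).Colorable k := by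
  classical
  rintro ⟨C⟩
  have hpop : ∀ w, ∃ a : Fin k, Fintype.card I ≤
      k * (Finset.univ.filter fun i => C (φ w i) = a).card := by
    intro w
    have hne : (Finset.univ : Finset (Fin k)).Nonempty := ⟨⟨0, hk⟩, Finset.mem_univ _⟩
    have hle : ∑ _a : Fin k, Fintype.card I ≤
        ∑ a : Fin k, k * (Finset.univ.filter fun i => C (φ w i) = a).card := by
      rw [← Finset.mul_sum, Finset.sum_const, Finset.card_univ, Fintype.card_fin, smul_eq_mul,
        ← Finset.card_eq_sum_card_fiberwise (s := Finset.univ) (t := Finset.univ)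
          (f := fun i => C (φ w i)) (by simp), Finset.card_univ]
    obtain ⟨a, _, ha⟩ := Finset.exists_le_of_sum_le hne hle
    exact ⟨a, ha⟩
  choose col hcol using hpop
  refine hF ⟨Coloring.mk col ?_⟩
  intro w w' hww' heq
  obtain ⟨y, hy, z, hz, hyz⟩ := hole w w' hww'.ne _ _ (hcol w) (hcol w')
  have hy' := (Finset.mem_filter.1 hy).2
  have hz' := (Finset.mem_filter.1 hz).2
  refine C.valid (show (levelGraph Γ F lev X B c).Adj (φ w y) (φ w' z) from
    ⟨hyz, Or.inl ⟨hX _ _, hX _ _, ?_⟩⟩) (hy'.trans (heq.trans hz'.symm))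
  rwa [hlev, hlev]

end Construction

lemma minDeg_le_degIn {n : ℕ} (G : SimpleGraph (Fin n)) (v : Fin n) :
    minDeg G ≤ degIn G v Finset.univ := by
  classical
  have h := G.minDegree_le_degree v
  rw [← card_neighborFinset_eq_degree, neighborFinset_eq_filter] at h
  unfold minDeg degIn
  convert h

lemma exists_degIn_eq_minDeg {n : ℕ} (hn : 0 < n) (G : SimpleGraph (Fin n)) :
    ∃ v, degIn G v Finset.univ = minDeg G := by
  classical
  have : Nonempty (Fin n) := ⟨⟨0, hn⟩⟩
  obtain ⟨v, hv⟩ := G.exists_minimal_degree_vertex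
  refine ⟨v, ?_⟩
  rw [← card_neighborFinset_eq_degree, neighborFinset_eq_filter] at hv
  unfold minDeg degIn
  convert hv.symm

open Classical in
/-- The deterministic part of the construction. -/
lemma exists_subgraph_of_levels {n s N k R : ℕ} (hn : 0 < n) (hR : 3 ≤ R) (hk : 0 < k) (hsk : s ≤ k)
    {Γ : SimpleGraph (Fin n)} (hF : ¬ (shiftGraph (2 * s + 1) N).Colorable k) {I : Type*} [Fintype I]
    {φ : (Fin (2 * s + 1) → Fin N) → I → Fin n}
    (hφ : ∀ i j a b, φ i a = φ j b → i = j ∧ a = b)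
    (hole : ∀ i j, i ≠ j → NoHole Γ k (φ i) (φ j)) {m β δ γ η x : ℝ}
    (hm : (Fintype.card (Fin (2 * s + 1) → Fin N) * Fintype.card I : ℝ) ≤ m)
    (hδ : ∀ (v : Fin n) (j : Fin R),
      δ ≤ degIn Γ v (Finset.univ.filter fun u : Fin n => (u : ℕ) % R ≠ j))
    (hmax : ∀ v : Fin n, (degIn Γ v Finset.univ : ℝ) ≤ x) (hη : m * x ≤ η)
    (hβ : ∀ M : Finset (Fin n), (M.card : ℝ) ≤ η →
      ((Finset.univ.filter fun v => γ ≤ degIn Γ v M).card : ℝ) ≤ β) (hγ : 0 ≤ γ) :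
    ∃ G : SimpleGraph (Fin n), G ≤ Γ ∧ (s : ℕ∞) ≤ G.chromaticNumber ∧
      δ - γ - β - m ≤ minDeg G ∧
      ∀ S : G.Subgraph, S.verts.ncard = s → S.coe.Colorable R := by
  let X : Finset (Fin n) :=
    (Finset.univ : Finset ((Fin (2 * s + 1) → Fin N) × I)).image fun y => φ y.1 y.2
  have hXcard : (X.card : ℝ) ≤ m := by
    refine le_trans ?_ hm
    have : X.card ≤ Fintype.card ((Fin (2 * s + 1) → Fin N) × I) := Finset.card_image_le
    rw [Fintype.card_prod] at this
    exact_mod_cast this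
  let M : Finset (Fin n) := X.biUnion fun v => {u | Γ.Adj v u}
  have hx : 0 ≤ x := le_trans (by positivity) (hmax ⟨0, hn⟩)
  have hM : (M.card : ℝ) ≤ η := by
    refine le_trans ?_ hη
    have h1 : M.card ≤ ∑ v ∈ X, degIn Γ v Finset.univ := Finset.card_biUnion_le
    calc (M.card : ℝ) ≤ ∑ v ∈ X, (degIn Γ v Finset.univ : ℝ) := by exact_mod_cast h1
      _ ≤ X.card • x := Finset.sum_le_card_nsmul _ _ _ fun v _ => hmax v
      _ ≤ m * x := by rw [nsmul_eq_mul]; exact mul_le_mul_of_nonneg_right hXcard hx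
  let B : Finset (Fin n) := Finset.univ.filter fun v => γ ≤ degIn Γ v M
  have hB : (B.card : ℝ) ≤ β := hβ M hM
  have hlev : ∃ lev : Fin n → Fin (2 * s + 1) → Fin N, ∀ w a, lev (φ w a) = w := by
    by_cases hW : Nonempty (Fin (2 * s + 1) → Fin N)
    · refine ⟨fun v => if h : ∃ w a, φ w a = v then h.choose else hW.some, fun w a => ?_⟩
      have h : ∃ w' a', φ w' a' = φ w a := ⟨w, a, rfl⟩
      obtain ⟨a', ha'⟩ := h.choose_spec
      simp only [dif_pos h]
      exact (hφ _ _ _ _ ha').1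
    · rw [not_nonempty_iff] at hW
      exact absurd ⟨Coloring.mk (fun w => hW.elim w) fun {w} => hW.elim w⟩ hF
  obtain ⟨lev, hlev⟩ := hlev
  -- Membership in `B` takes precedence. Vertices of `B` may have many neighbours in `M`, so they
  -- get a colour other than `0`; this is harmless since `X` sends no edges to `B`.
  let c : Fin n → Fin R := fun v =>
    if v ∈ B then ⟨1, by omega⟩ else if v ∈ M then ⟨0, by omega⟩ else
      ⟨v % R, Nat.mod_lt _ (by omega)⟩
  let G := levelGraph Γ (shiftGraph (2 * s + 1) N) lev (X : Set (Fin n)) (B : Set (Fin n)) c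
  refine ⟨G, levelGraph_le, ?_, ?_, ?_⟩
  · have hnot : ¬ G.Colorable k := not_colorable_levelGraph hk hF
      (fun w a => Finset.mem_coe.2 (Finset.mem_image.2 ⟨(w, a), Finset.mem_univ _, rfl⟩)) hlev hole
    refine le_of_not_gt fun h => hnot ?_
    have h2 : G.chromaticNumber ≤ (k : ℕ∞) := h.le.trans (by exact_mod_cast hsk)
    exact chromaticNumber_le_iff_colorable.1 h2
  · obtain ⟨v, hv⟩ := exists_degIn_eq_minDeg hn G
    rw [← hv]
    -- Here `j` is the residue class sacrificed at `v`. The set `E` holds the neighbours in `M`,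
    -- which are few when `v ∉ B`; it is empty when `v` lies in `X` or `B`.
    obtain ⟨j, E, hE, hcov⟩ : ∃ (j : Fin R) (E : Finset (Fin n)), (E.card : ℝ) ≤ γ ∧
        ∀ u : Fin n, (u : ℕ) % R ≠ j → Γ.Adj v u → u ∉ X → u ∉ B → u ∉ E → G.Adj v u := by
      by_cases hvX : v ∈ X
      · refine ⟨⟨0, by omega⟩, ∅, by simpa using hγ, fun u _ hadj huX huB _ => ?_⟩
        exact ⟨hadj, Or.inr (Or.inl ⟨hvX, huX, huB⟩)⟩
      by_cases hvB : v ∈ B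
      · refine ⟨⟨1, by omega⟩, ∅, by simpa using hγ, fun u hu hadj huX huB _ => ?_⟩
        refine ⟨hadj, Or.inr (Or.inr (Or.inr ⟨hvX, huX, ?_⟩))⟩
        simp only [c, if_pos hvB, if_neg huB]
        split_ifs
        · simp
        · exact fun h => hu (Fin.mk.inj h).symm
      · refine ⟨c v, {u ∈ M | Γ.Adj v u}, ?_, fun u hu hadj huX huB huE => ?_⟩
        · have : ¬ γ ≤ degIn Γ v M := fun h => hvB (Finset.mem_filter.2 ⟨Finset.mem_univ _, h⟩)
          exact (not_le.1 this).le
        · refine ⟨hadj, Or.inr (Or.inr (Or.inr ⟨hvX, huX, fun h => hu ?_⟩))⟩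
          have huM : u ∉ M := fun h => huE (Finset.mem_filter.2 ⟨h, hadj⟩)
          rw [h]
          simp only [c, if_neg huB, if_neg huM]
    have h1 : degIn Γ v (Finset.univ.filter fun u : Fin n => (u : ℕ) % R ≠ j) ≤
        degIn G v Finset.univ + X.card + B.card + E.card := by
      unfold degIn
      refine (Finset.card_le_card (t := Finset.univ.filter (fun u => G.Adj v u) ∪ X ∪ B ∪ E) fun u hu => ?_).trans ?_
      · simp only [Finset.mem_filter, Finset.mem_univ, true_and] at hu
        by_contra hno
        simp only [Finset.mem_union, Finset.mem_filter, Finset.mem_univ, true_and, not_or] at hno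
        exact hno.1.1.1 (hcov u hu.1 hu.2 hno.1.1.2 hno.1.2 hno.2)
      · refine (Finset.card_union_le _ _).trans (Nat.add_le_add_right ?_ _)
        refine (Finset.card_union_le _ _).trans (Nat.add_le_add_right ?_ _)
        exact Finset.card_union_le _ _
    have h2 : (degIn Γ v (Finset.univ.filter fun u : Fin n => (u : ℕ) % R ≠ j) : ℝ) ≤
        degIn G v Finset.univ + X.card + B.card + E.card := by exact_mod_cast h1
    have h3 := hδ v j
    linarith
  · intro S hS
    refine coe_colorable_of_levelGraph hR ?_ S (Set.toFinite _) hS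
    intro y hy v _ hvB hadj
    have hvM : v ∈ M := Finset.mem_biUnion.2 ⟨y, hy, by simpa using hadj⟩
    have hvB' : v ∉ B := hvB
    simp only [c, if_neg hvB', if_pos hvM]

/-! ### Assembly and the chromatic threshold. -/

section

variable {p : ℕ → unitInterval}

lemma whp_exists_locally_colorable_subgraph
    (hp_lower : (fun n : ℕ => (n : ℝ) ^ (-(1 / 2) : ℝ)) =o[atTop] (fun n => (p n : ℝ)))
    (hp_upper : (fun n : ℕ => (p n : ℝ)) =o[atTop] (fun _ => (1 : ℝ)))
    (r s : ℕ) {γ : ℝ} (hr : 4 ≤ r) (hγ : 0 < γ) :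
    Whp p fun n Γ => ∃ G : SimpleGraph (Fin n), G ≤ Γ ∧ (s : ℕ∞) ≤ G.chromaticNumber ∧
      (((r : ℝ) - 2) / ((r : ℝ) - 1) - γ) * (p n : ℝ) * (n : ℝ) ≤ (minDeg G : ℝ) ∧
      ∀ S : G.Subgraph, S.verts.ncard = s → S.coe.Colorable (r - 1) := by
  classical
  obtain ⟨N, hN⟩ := exists_not_colorable_shiftGraph (2 * s) (s + 1)
  have hW : Nonempty (Fin (2 * s + 1) → Fin N) := by
    by_contra hW
    rw [not_nonempty_iff] at hW
    exact hN ⟨Coloring.mk (fun w => hW.elim w) fun {w} => hW.elim w⟩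
  -- Then `|X|` times the maximum degree is at most `(ε/p) * 4pn ≤ γn/32`, as required for `M`. The
  -- degree losses `γ/4`, `γ/4`, `γ/16` and `γ/128`, in units of `pn`, total less than `γ`.
  set ε := min 1 (γ / 128) with hε
  have hε0 : 0 < ε := by positivity
  have hεγ : ε ≤ γ / 128 := min_le_right _ _
  have h1 := whp_exists_levels (F := Fin (2 * s + 1) → Fin N) hp_lower hp_upper
    (k := s + 1) (by omega) hε0 (min_le_left _ _)
  have h2 := whp_le_degIn hp_lower (R := r - 1) (by omega) (show 0 < γ / 4 by positivity)
  have h3 := whp_degIn_univ_le hp_lower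
  have h4 := whp_card_le_of_degIn hp_lower (γ := γ / 4) (β := γ / 16) (η := γ / 32)
    (by positivity) (by linarith) (by linarith)
  refine (((h1.and h2).and h3).and h4).mono ?_
  filter_upwards [eventually_gt_atTop 0, eventually_le_mul_sqrt hp_lower one_pos]
    with n hn hp1 Γ ⟨⟨⟨⟨D, L, φ, hD, hL, hcard, hφ, hole⟩, hδ⟩, hmax⟩, hβ⟩
  have hn' : (0 : ℝ) < n := by exact_mod_cast hn
  have hp0 : 0 < (p n : ℝ) := by
    rcases (p n).2.1.lt_or_eq with h | h
    · exact h
    · rw [← h] at hp1; norm_num at hp1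
  -- Makes `|X| ≤ ε/p` at most `ε p n`, so losing all neighbours in `X` is affordable.
  have hpp : 1 ≤ (p n : ℝ) * (p n * n) := by
    have h5 := pow_le_pow_left₀ zero_le_one hp1 2
    rw [mul_pow, Real.sq_sqrt hn'.le] at h5
    linarith
  have hr' : ((r - 1 : ℕ) : ℝ) = r - 1 := by
    rw [Nat.cast_sub (by omega), Nat.cast_one]
  obtain ⟨G, hG, hχ, hdeg, hcol⟩ := exists_subgraph_of_levels (s := s) (R := r - 1) (k := s + 1)
    (m := ε / p n) (x := 4 * (p n * n)) (η := γ / 32 * n) (β := γ / 16 * (p n * n))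
    (γ := γ / 4 * (p n * n)) hn (by omega) (by omega) (by omega) hN hφ hole
    (by
      rw [le_div_iff₀ hp0, Fintype.card_prod, Fintype.card_fin D, Fintype.card_fin L]
      push_cast at hcard ⊢
      exact hcard) hδ hmax
    (by
      rw [div_mul_eq_mul_div, div_le_iff₀ hp0]
      have := mul_le_mul_of_nonneg_right hεγ (show 0 ≤ 4 * ((p n : ℝ) * n) by positivity)
      linarith) hβ (by positivity)
  refine ⟨G, hG, hχ, le_trans ?_ hdeg, hcol⟩
  have hm : ε / p n ≤ γ / 128 * (p n * n) := by
    rw [div_le_iff₀ hp0]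
    have h6 := mul_le_mul_of_nonneg_left hpp (show 0 ≤ γ / 128 by positivity)
    linarith
  have hx0 : 0 ≤ γ * ((p n : ℝ) * n) := by positivity
  rw [hr', show (r : ℝ) - 1 - 1 = r - 2 by ring, mul_assoc]
  linarith

/-- Needed because the infimum of an empty set of reals is `0` by convention. Density `5` works
vacuously, the maximum degree being at most `4pn` with high probability. -/
lemma chromaticThresholdSet_nonempty {W : Type*} (H : SimpleGraph W)
    (hp_lower : (fun n : ℕ => (n : ℝ) ^ (-(1 / 2) : ℝ)) =o[atTop] (fun n => (p n : ℝ))) :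
    (chromaticThresholdSet H p).Nonempty := by
  classical
  refine ⟨5, by norm_num, 1, one_pos, (whp_degIn_univ_le hp_lower).mono ?_⟩
  filter_upwards [eventually_gt_atTop 0, eventually_sqrt_le_prob_mul hp_lower]
    with n hn hpn Γ hΓ G hG _ hdeg
  exfalso
  have hpn0 : 0 < (p n : ℝ) * n :=
    (Real.sqrt_pos.2 (show (0 : ℝ) < n by exact_mod_cast hn)).trans_le hpn
  have h1 := minDeg_le_degIn G ⟨0, hn⟩
  have h2 : degIn G ⟨0, hn⟩ Finset.univ ≤ degIn Γ ⟨0, hn⟩ Finset.univ :=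
    Finset.card_le_card (Finset.monotone_filter_right _ fun u _ h => hG h)
  have h3 : (minDeg G : ℝ) ≤ degIn Γ ⟨0, hn⟩ Finset.univ := by exact_mod_cast h1.trans h2
  have h4 := hΓ ⟨0, hn⟩
  linarith

/-- A copy of `H` lies in a subgraph with any prescribed number of vertices that is large enough. -/
lemma colorable_of_isContained {V W : Type*} [Finite V] [Finite W] {H : SimpleGraph W}
    {G : SimpleGraph V} {s k : ℕ} (hWs : Nat.card W ≤ s) (hs : s ≤ Nat.card V)
    (hG : ∀ S : G.Subgraph, S.verts.ncard = s → S.coe.Colorable k) (hHG : H.IsContained G) :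
    H.Colorable k := by
  obtain ⟨f⟩ := hHG
  have h1 : (Set.range f).ncard ≤ s := by
    rw [← Set.image_univ]
    exact (Set.ncard_image_le Set.finite_univ).trans (by rwa [Set.ncard_univ])
  obtain ⟨t, ht, _, hts⟩ := Set.exists_subsuperset_card_eq (Set.subset_univ (Set.range f)) h1
    (by rwa [Set.ncard_univ])
  obtain ⟨C⟩ := hG ((⊤ : G.Subgraph).induce t) hts
  refine ⟨Coloring.mk (fun w => C ⟨f w, ht ⟨w, rfl⟩⟩) fun {a b} hab => C.valid ?_⟩
  simp only [Subgraph.coe_adj, Subgraph.induce_adj, Subgraph.top_adj]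
  exact ⟨ht ⟨a, rfl⟩, ht ⟨b, rfl⟩, f.toHom.map_adj hab⟩

lemma piDensity_le_chromaticThreshold
    (hp_lower : (fun n : ℕ => (n : ℝ) ^ (-(1 / 2) : ℝ)) =o[atTop] (fun n => (p n : ℝ)))
    (hp_upper : (fun n : ℕ => (p n : ℝ)) =o[atTop] (fun _ => (1 : ℝ)))
    {W : Type*} [Finite W] (H : SimpleGraph W) (hH : 4 ≤ H.chromaticNumber) :
    piDensity H ≤ chromaticThreshold H p := by
  refine le_csInf (chromaticThresholdSet_nonempty H hp_lower) ?_
  rintro d ⟨_, C, _, hC⟩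
  by_contra! hd
  have := Fintype.ofFinite W
  obtain ⟨r, hr⟩ : ∃ r : ℕ, H.chromaticNumber = r :=
    ENat.ne_top_iff_exists.1 (chromaticNumber_ne_top_iff_exists.2
      ⟨_, H.colorable_of_fintype⟩) |>.imp fun _ h => h.symm
  have hr4 : 4 ≤ r := by rw [hr] at hH; exact_mod_cast hH
  have hr4' : (4 : ℝ) ≤ r := by exact_mod_cast hr4
  have hpi : piDensity H = ((r : ℝ) - 2) / (r - 1) := by
    have : (r : ℝ) - 1 ≠ 0 := by linarith
    rw [piDensity, hr, ENat.toNat_natCast]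
    field_simp
    ring
  -- The size `s` is at least `|W|`, so a copy of `H` would be `(r-1)`-colourable, and greater than
  -- `C`, so `χ(G) ≤ C` fails. The slack is `γ = π(H) - d`.
  have h1 := whp_exists_locally_colorable_subgraph hp_lower hp_upper r
    (max (Nat.card W) (C + 1)) hr4 (sub_pos.2 hd)
  obtain ⟨n, ⟨Γ, hΓ, G, hG, hχ, hdeg, hcol⟩, hn⟩ :=
    ((hC.and h1).exists.and (eventually_ge_atTop (max (Nat.card W) (C + 1)))).exists
  have hfree : H.Free G := by
    intro hcon
    have := colorable_of_isContained (le_max_left _ _) (by simpa using hn) hcol hcon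
    have h2 := chromaticNumber_le_iff_colorable.2 this
    rw [hr, Nat.cast_le] at h2
    omega
  have hle := hΓ G hG hfree (by rwa [← hpi, sub_sub_cancel] at hdeg)
  have h3 := hχ.trans hle
  rw [Nat.cast_le] at h3
  have := le_max_right (Nat.card W) (C + 1)
  omega

end

end SparseChromatic

theorem theorem3p5 (p : ℕ → unitInterval)
    (hp_lower : (fun n : ℕ => (n : ℝ) ^ (-(1 / 2) : ℝ)) =o[Filter.atTop] (fun n => (p n : ℝ)))
    (hp_upper : (fun n : ℕ => (p n : ℝ)) =o[Filter.atTop] (fun _ => (1 : ℝ))) :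
    (∀ (r s : ℕ) (γ : ℝ), 4 ≤ r → 0 < γ →
      SparseChromatic.Whp p fun n Γ => ∃ G : SimpleGraph (Fin n), G ≤ Γ ∧
        (s : ℕ∞) ≤ G.chromaticNumber ∧
        (((r : ℝ) - 2) / ((r : ℝ) - 1) - γ) * (p n : ℝ) * (n : ℝ) ≤
          (SparseChromatic.minDeg G : ℝ) ∧
        ∀ S : G.Subgraph, S.verts.ncard = s → S.coe.Colorable (r - 1)) ∧
    (∀ (W : Type*) [Finite W] (H : SimpleGraph W), 4 ≤ H.chromaticNumber →
      SparseChromatic.piDensity H ≤ SparseChromatic.chromaticThreshold H p) := by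
  exact ⟨fun r s γ hr hγ =>
      SparseChromatic.whp_exists_locally_colorable_subgraph hp_lower hp_upper r s hr hγ,
    fun _ _ H hH => SparseChromatic.piDensity_le_chromaticThreshold hp_lower hp_upper H hH⟩
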